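/- Let $M(x,t)$ be a complex-valued integrable function on the triangle $0\le t\le x\le\pi$. For a function $q:[0,\pi]\to\mathbb C$ and $\lambda\in\mathbb C$ let $\Phi(x,\lambda)$ be the solution of $$-y''(x)+q(x)y(x)+\int_0^x M(x,t)y(t)\,dt=\lambda y(x),\qquad x\in[0,\pi],$$ with $\Phi(0,\lambda)=1$, $\Phi(\pi,\lambda)=0$ (solutions have absolutely continuous first derivative on $[0,\pi]$ and satisfy the equation almost everywhere), and let $N(\lambda):=\Phi'(0,\lambda)$ be the Weyl-type function, defined for those $\lambda$ for which $\Phi(\cdot,\lambda)$ exists and is unique. For another function $\tilde q$ and the same $M$ let $\tilde N(\lambda)$ be the corresponding Weyl-type function. Fix $\delta\in(0,\pi/2)$ and put $Q:=\{\rho\in\mathbb C:\ \arg\rho\in[\delta,\pi-\delta]\}$. **Lemma 3.** Fix an integer $k\ge 0$. Let $q$ and $\tilde q$ be complex-valued and analytic on $[0,\pi]$ (at the endpoints, one-sidedly), put $q_j:=q^{(j)}(0)$, $\tilde q_j:=\tilde q^{(j)}(0)$, $\hat q_j:=q_j-\tilde q_j$, and suppose that $\hat q_j=0$ for $0\le j\le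 k-1$. Then $N(\rho^2)$ and $\tilde N(\rho^2)$ are defined for all $\rho\in Q$ with $|\rho|$ sufficiently large, and $$\hat q_k=-\lim_{|\rho|\to\infty,\ \rho\in Q}(-2i\rho)^{k+1}\bigl(N(\rho^2)-\tilde N(\rho^2)\bigr).$$ -/

import Mathlib

open Set Filter Topology MeasureTheory

noncomputable section

/-- `y` solves `-y''(x) + q(x) y(x) + ∫₀ˣ M(x,t) y(t) dt = lam y(x)` on `[0,π]`, in the
Carathéodory sense: `y` is differentiable on `[0,π]` (one-sidedly at the endpoints), `y'` is
absolutely continuous on `[0,π]`, and the equation holds for almost every `x ∈ [0,π]`. -/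
structure IsSolution (q : ℝ → ℂ) (M : ℝ → ℝ → ℂ) (lam : ℂ) (y : ℝ → ℂ) : Prop where
  differentiableOn : DifferentiableOn ℝ y (Icc 0 Real.pi)
  absolutelyContinuous :
    AbsolutelyContinuousOnInterval (derivWithin y (Icc 0 Real.pi)) 0 Real.pi
  equation : ∀ᵐ x ∂(volume.restrict (Icc 0 Real.pi)),
    -derivWithin (derivWithin y (Icc 0 Real.pi)) (Icc 0 Real.pi) x + q x * y x
      + ∫ t in (0 : ℝ)..x, M x t * y t = lam * y x

/-- `Φ` is a solution `Φ(·,lam)` of the boundary value problem `Φ(0) = 1`, `Φ(π) = 0`. -/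
def IsWeylSolution (q : ℝ → ℂ) (M : ℝ → ℝ → ℂ) (lam : ℂ) (Φ : ℝ → ℂ) : Prop :=
  IsSolution q M lam Φ ∧ Φ 0 = 1 ∧ Φ Real.pi = 0

/-- The boundary value problem defining `Φ(·,lam)` has exactly one solution on `[0,π]`, so that
the Weyl-type function is defined at `lam`. -/
def WeylDefinedAt (q : ℝ → ℂ) (M : ℝ → ℝ → ℂ) (lam : ℂ) : Prop :=
  (∃ Φ, IsWeylSolution q M lam Φ) ∧
    ∀ Φ Ψ, IsWeylSolution q M lam Φ → IsWeylSolution q M lam Ψ → EqOn Φ Ψ (Icc 0 Real.pi)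

open Classical in
/-- The Weyl-type function `N(lam) = Φ'(0,lam)`; the value `0` where `Φ(·,lam)` is not uniquely
determined is a convention. -/
def weylN (q : ℝ → ℂ) (M : ℝ → ℝ → ℂ) (lam : ℂ) : ℂ :=
  if h : WeylDefinedAt q M lam then derivWithin h.1.choose (Icc 0 Real.pi) 0 else 0

/-- The sector `{ρ : arg ρ ∈ [δ, π - δ]}`. -/
def sectorQ (δ : ℝ) : Set ℂ := {ρ | Complex.arg ρ ∈ Icc δ (Real.pi - δ)}

/-- The Taylor coefficient `q_j = q^{(j)}(0)` of a function on `[0,π]`. -/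
def taylorCoeffZero (q : ℝ → ℂ) (j : ℕ) : ℂ := iteratedDerivWithin j q (Icc 0 Real.pi) 0

end

/-! ### Absolutely continuous complex-valued functions -/

/-! Write `P x = sin ρ(π - x) / sin ρπ` for the solution of the free problem, `G` for the Dirichlet
Green function, and `B(z, y) = ∫ q z y + ∫∫ M(x,t) z(x) y(t)`. The boundary value problem is
equivalent to `Φ x = P x - B(G x, Φ)`, and `N = -ρ cot ρπ - B(P, Φ)`. High in the upper half-plane
`‖G‖ ≤ 4 / ‖ρ‖`, so the integral equation is uniquely solvable by contraction
(`weylDefinedAt_of_greenKernel_le`).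

If `z` solves the transposed equation `z x = P x - B(z, G x)`, symmetry of `G` and Fubini give `N -
Ñ = -∫ (q - q̃) z Φ̃` (`densityForm_sub_densityForm_eq`); the kernel `M`, common to both problems,
drops out.

The delicate point is the size of `z Φ̃`. Since `M(x,t)` carries values from small `t` to large `x`,
`Φ̃` need not decay like `exp(iρx)`; the argument uses only that it is uniformly within `O(1/ρ)` of
it. In the transposed equation values travel from large to small arguments, so `z` keeps the bound
`exp(-x Im ρ)` (`exists_eq_sub_densityForm_left_of_le`). One decaying factor is enough: `z Φ̃ =
exp(2iρx) + O(1/ρ) exp(-x Im ρ)`.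

As `q - q̃` vanishes to order `k` at `0`, Watson's lemma (`norm_laplace_sub_le`) gives the main term
`q̂_k / (-2iρ)^(k+1)`. In the sector `Im ρ` is comparable to `‖ρ‖`, so both errors are
`O(‖ρ‖^(-k-2))`. -/

theorem LipschitzWith.comp_absolutelyContinuousOnInterval {X Y : Type*} [PseudoMetricSpace X]
    [PseudoMetricSpace Y] {g : X → Y} (hg : LipschitzWith 1 g) {f : ℝ → X} {a b : ℝ}
    (hf : AbsolutelyContinuousOnInterval f a b) :
    AbsolutelyContinuousOnInterval (fun x => g (f x)) a b := by
  refine squeeze_zero (fun t => Finset.sum_nonneg fun i _ => dist_nonneg) (fun t => ?_) hf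
  exact Finset.sum_le_sum fun i _ => by simpa using hg.dist_le_mul _ _

theorem AbsolutelyContinuousOnInterval.congr_of_eqOn {X : Type*} [PseudoMetricSpace X]
    {f g : ℝ → X} {a b : ℝ} (hg : AbsolutelyContinuousOnInterval g a b)
    (h : EqOn f g (uIcc a b)) : AbsolutelyContinuousOnInterval f a b := by
  rw [absolutelyContinuousOnInterval_iff] at hg ⊢
  intro ε hε
  obtain ⟨δ, hδ, H⟩ := hg ε hε
  refine ⟨δ, hδ, fun E hE hEd => ?_⟩
  convert H E hE hEd using 1
  refine Finset.sum_congr rfl fun i hi => ?_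
  rw [h (hE.1 i hi).1, h (hE.1 i hi).2]

theorem absolutelyContinuousOnInterval_ofReal_add_mul_I {u v : ℝ → ℝ} {a b : ℝ}
    (hu : AbsolutelyContinuousOnInterval u a b) (hv : AbsolutelyContinuousOnInterval v a b) :
    AbsolutelyContinuousOnInterval (fun x => (u x : ℂ) + Complex.I * (v x : ℂ)) a b := by
  have h : LipschitzWith 1 (fun x : ℝ => (x : ℂ)) := Complex.isometry_ofReal.lipschitz
  exact (h.comp_absolutelyContinuousOnInterval hu).fun_add
    ((h.comp_absolutelyContinuousOnInterval hv).const_smul Complex.I)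

theorem IntervalIntegrable.absolutelyContinuousOnInterval_complex {f : ℝ → ℂ} {a b : ℝ}
    (h : IntervalIntegrable f volume a b) :
    AbsolutelyContinuousOnInterval (fun x => ∫ t in a..x, f t) a b := by
  have hre : IntervalIntegrable (fun x => (f x).re) volume a b := ⟨h.1.re, h.2.re⟩
  have him : IntervalIntegrable (fun x => (f x).im) volume a b := ⟨h.1.im, h.2.im⟩
  have key := absolutelyContinuousOnInterval_ofReal_add_mul_I
    (hre.absolutelyContinuousOnInterval_intervalIntegral (c := a) (by simp))
    (him.absolutelyContinuousOnInterval_intervalIntegral (c := a) (by simp))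
  have hEq : ∀ x ∈ uIcc a b, (∫ t in a..x, f t)
      = ((∫ t in a..x, (f t).re : ℝ) : ℂ) + Complex.I * ((∫ t in a..x, (f t).im : ℝ) : ℂ) := by
    intro x hx
    have hfx : IntervalIntegrable f volume a x :=
      h.mono_set (uIcc_subset_uIcc left_mem_uIcc hx)
    have h1 := Complex.reCLM.intervalIntegral_comp_comm hfx
    have h2 := Complex.imCLM.intervalIntegral_comp_comm hfx
    simp only [Complex.reCLM_apply, Complex.imCLM_apply] at h1 h2
    rw [h1, h2, mul_comm]
    exact (Complex.re_add_im _).symm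
  exact key.congr_of_eqOn hEq

theorem AbsolutelyContinuousOnInterval.ae_differentiableAt_complex {f : ℝ → ℂ} {a b : ℝ}
    (hf : AbsolutelyContinuousOnInterval f a b) :
    ∀ᵐ x : ℝ, x ∈ uIcc a b → DifferentiableAt ℝ f x :=
  hf.boundedVariationOn.ae_differentiableAt_of_mem_uIcc

theorem AbsolutelyContinuousOnInterval.intervalIntegrable_of_ae_hasDerivAt {f f' : ℝ → ℂ}
    {a b : ℝ} (hf : AbsolutelyContinuousOnInterval f a b)
    (h : ∀ᵐ x, x ∈ uIcc a b → HasDerivAt f (f' x) x) : IntervalIntegrable f' volume a b := by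
  have lre : LipschitzWith 1 Complex.re := by
    refine LipschitzWith.mk_one fun x y => ?_
    rw [Real.dist_eq, Complex.dist_eq, ← Complex.sub_re]; exact Complex.abs_re_le_norm _
  have lim : LipschitzWith 1 Complex.im := by
    refine LipschitzWith.mk_one fun x y => ?_
    rw [Real.dist_eq, Complex.dist_eq, ← Complex.sub_im]; exact Complex.abs_im_le_norm _
  have ire := (lre.comp_absolutelyContinuousOnInterval hf).intervalIntegrable_deriv
  have iim := (lim.comp_absolutelyContinuousOnInterval hf).intervalIntegrable_deriv
  have key : IntervalIntegrable (fun x => ((deriv (fun x => (f x).re) x : ℝ) : ℂ)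
      + Complex.I * ((deriv (fun x => (f x).im) x : ℝ) : ℂ)) volume a b :=
    IntervalIntegrable.add ⟨Integrable.ofReal ire.1, Integrable.ofReal ire.2⟩
      (IntervalIntegrable.const_mul ⟨Integrable.ofReal iim.1, Integrable.ofReal iim.2⟩ _)
  refine key.congr_ae ?_
  rw [EventuallyEq, ae_restrict_iff' measurableSet_uIoc]
  filter_upwards [h] with x hx hxm
  have hd := hx (uIoc_subset_uIcc hxm)
  have e1 : deriv (fun x => (f x).re) x = (f' x).re :=
    (Complex.reCLM.hasFDerivAt.comp_hasDerivAt x hd).deriv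
  have e2 : deriv (fun x => (f x).im) x = (f' x).im :=
    (Complex.imCLM.hasFDerivAt.comp_hasDerivAt x hd).deriv
  rw [e1, e2, mul_comm]
  exact Complex.re_add_im _

/-- `f` minus the primitive of `f'` is absolutely continuous with derivative zero almost everywhere,
hence constant. -/
theorem AbsolutelyContinuousOnInterval.integral_eq_sub_of_ae_hasDerivAt {f f' : ℝ → ℂ} {a b : ℝ}
    (hf : AbsolutelyContinuousOnInterval f a b)
    (h : ∀ᵐ x, x ∈ uIcc a b → HasDerivAt f (f' x) x) : ∫ x in a..b, f' x = f b - f a := by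
  have hi := hf.intervalIntegrable_of_ae_hasDerivAt h
  have hg := hf.fun_sub hi.absolutelyContinuousOnInterval_complex
  obtain ⟨C, hC⟩ := hg.const_of_ae_hasDerivAt_zero (by
    filter_upwards [h, hi.ae_hasDerivAt_integral] with x hx₁ hx₂ hx₃
    simpa using (hx₁ hx₃).fun_sub (hx₂ hx₃ a (by simp)))
  have h1 := hC a (by simp)
  have h2 := hC b (by simp)
  simp only [intervalIntegral.integral_same, sub_zero] at h1
  rw [h1, ← h2]; ring

/-! ### Bilinear forms given by an integrable density -/

noncomputable section

/-- The bilinear form `(z, y) ↦ ∫ a ω * z (l ω) * y (r ω) ∂μ`. -/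
def densityForm {Ω : Type*} [MeasurableSpace Ω] (μ : Measure Ω) (a : Ω → ℂ) (l r : Ω → ℝ)
    (z y : ℝ → ℂ) : ℂ := ∫ ω, a ω * z (l ω) * y (r ω) ∂μ

section densityForm

variable {Ω : Type*} [MeasurableSpace Ω] {μ : Measure Ω} {a : Ω → ℂ} {l r : Ω → ℝ} {b : ℝ}

theorem ContinuousOn.aestronglyMeasurable_comp_of_ae_mem_Icc {y : ℝ → ℂ} (hb : 0 ≤ b)
    (hy : ContinuousOn y (Icc 0 b)) (hr : Measurable r) (hrb : ∀ᵐ ω ∂μ, r ω ∈ Icc 0 b) :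
    AEStronglyMeasurable (fun ω => y (r ω)) μ := by
  -- `y` is controlled only on `[0, b]`; its constant extension is continuous on the line and agrees
  -- with it along `r` almost everywhere.
  have hc : Continuous (IccExtend hb ((Icc 0 b).domRestrict y)) :=
    hy.domRestrict.Icc_extend'
  refine (hc.measurable.comp hr).aestronglyMeasurable.congr ?_
  filter_upwards [hrb] with ω hω
  simp only [Function.comp_apply]
  rw [IccExtend_of_mem hb _ hω]; rfl

theorem densityForm_integrable {z y : ℝ → ℂ} (hb : 0 ≤ b) (ha : Integrable a μ)
    (hl : Measurable l) (hr : Measurable r) (hlb : ∀ᵐ ω ∂μ, l ω ∈ Icc 0 b)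
    (hrb : ∀ᵐ ω ∂μ, r ω ∈ Icc 0 b) (hz : ContinuousOn z (Icc 0 b))
    (hy : ContinuousOn y (Icc 0 b)) :
    Integrable (fun ω => a ω * z (l ω) * y (r ω)) μ := by
  obtain ⟨A, hA⟩ := isCompact_Icc.exists_bound_of_continuousOn hz
  obtain ⟨B, hB⟩ := isCompact_Icc.exists_bound_of_continuousOn hy
  refine (ha.mul_bdd (c := A) (hz.aestronglyMeasurable_comp_of_ae_mem_Icc hb hl hlb) ?_).mul_bdd (c := B)
    (hy.aestronglyMeasurable_comp_of_ae_mem_Icc hb hr hrb) ?_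
  · filter_upwards [hlb] with ω hω using hA _ hω
  · filter_upwards [hrb] with ω hω using hB _ hω

theorem norm_densityForm_le {z y : ℝ → ℂ} {A B : ℝ} (ha : Integrable a μ)
    (hlb : ∀ᵐ ω ∂μ, l ω ∈ Icc 0 b) (hrb : ∀ᵐ ω ∂μ, r ω ∈ Icc 0 b)
    (hz : ∀ x ∈ Icc 0 b, ‖z x‖ ≤ A) (hy : ∀ x ∈ Icc 0 b, ‖y x‖ ≤ B) :
    ‖densityForm μ a l r z y‖ ≤ A * (∫ ω, ‖a ω‖ ∂μ) * B := by
  rw [mul_assoc, mul_comm, mul_assoc, ← integral_mul_const]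
  refine norm_integral_le_of_norm_le (ha.norm.mul_const _) ?_
  filter_upwards [hlb, hrb] with ω h1 h2
  rw [norm_mul, norm_mul, mul_assoc, mul_comm B A]
  have := hz _ h1
  have := hy _ h2
  have : 0 ≤ A := (norm_nonneg _).trans (hz _ h1)
  gcongr

theorem densityForm_sub_right {z y y' : ℝ → ℂ} (hb : 0 ≤ b) (ha : Integrable a μ)
    (hl : Measurable l) (hr : Measurable r) (hlb : ∀ᵐ ω ∂μ, l ω ∈ Icc 0 b)
    (hrb : ∀ᵐ ω ∂μ, r ω ∈ Icc 0 b) (hz : ContinuousOn z (Icc 0 b))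
    (hy : ContinuousOn y (Icc 0 b)) (hy' : ContinuousOn y' (Icc 0 b)) :
    densityForm μ a l r z (fun x => y x - y' x)
      = densityForm μ a l r z y - densityForm μ a l r z y' := by
  rw [densityForm, densityForm, densityForm, ← integral_sub
    (densityForm_integrable hb ha hl hr hlb hrb hz hy)
    (densityForm_integrable hb ha hl hr hlb hrb hz hy')]
  simp only [mul_sub]

/-- Exchanging `l` and `r` transposes the form, so facts about the right argument also serve the
left one and the transposed equation. -/
theorem densityForm_swap (z y : ℝ → ℂ) :
    densityForm μ a l r z y = densityForm μ a r l y z := by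
  simp only [densityForm, mul_right_comm]

theorem densityForm_congr {z z' y y' : ℝ → ℂ} (hlb : ∀ᵐ ω ∂μ, l ω ∈ Icc 0 b)
    (hrb : ∀ᵐ ω ∂μ, r ω ∈ Icc 0 b) (hz : EqOn z z' (Icc 0 b)) (hy : EqOn y y' (Icc 0 b)) :
    densityForm μ a l r z y = densityForm μ a l r z' y' := by
  refine integral_congr_ae ?_
  filter_upwards [hlb, hrb] with ω h1 h2
  rw [hz h1, hy h2]

theorem densityForm_sub_left {z z' y : ℝ → ℂ} (hb : 0 ≤ b) (ha : Integrable a μ)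
    (hl : Measurable l) (hr : Measurable r) (hlb : ∀ᵐ ω ∂μ, l ω ∈ Icc 0 b)
    (hrb : ∀ᵐ ω ∂μ, r ω ∈ Icc 0 b) (hz : ContinuousOn z (Icc 0 b))
    (hz' : ContinuousOn z' (Icc 0 b)) (hy : ContinuousOn y (Icc 0 b)) :
    densityForm μ a l r (fun x => z x - z' x) y
      = densityForm μ a l r z y - densityForm μ a l r z' y := by
  rw [densityForm_swap, densityForm_sub_right hb ha hr hl hrb hlb hy hz hz',
    densityForm_swap y, densityForm_swap y]

theorem continuousOn_densityForm {H : ℝ → ℝ → ℂ} {y : ℝ → ℂ} (hb : 0 ≤ b) (ha : Integrable a μ)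
    (hl : Measurable l) (hr : Measurable r) (hlb : ∀ᵐ ω ∂μ, l ω ∈ Icc 0 b)
    (hrb : ∀ᵐ ω ∂μ, r ω ∈ Icc 0 b) (hH : Continuous (Function.uncurry H))
    (hy : ContinuousOn y (Icc 0 b)) :
    ContinuousOn (fun x => densityForm μ a l r (H x) y) (Icc 0 b) := by
  obtain ⟨A, hA⟩ := (isCompact_Icc.prod isCompact_Icc :
    IsCompact (Icc (0 : ℝ) b ×ˢ Icc (0 : ℝ) b)).exists_bound_of_continuousOn hH.continuousOn
  obtain ⟨B, hB⟩ := isCompact_Icc.exists_bound_of_continuousOn hy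
  refine continuousOn_of_dominated (bound := fun ω => ‖a ω‖ * (A * B)) (fun x hx => ?_)
    (fun x hx => ?_) (ha.norm.mul_const _) ?_
  · exact (densityForm_integrable hb ha hl hr hlb hrb
      (hH.uncurry_left x).continuousOn hy).aestronglyMeasurable
  · filter_upwards [hlb, hrb] with ω h1 h2
    have e1 := hA (x, l ω) ⟨hx, h1⟩
    have e2 := hB _ h2
    have e3 : 0 ≤ A := (norm_nonneg _).trans e1
    simp only [Function.uncurry_apply_pair] at e1
    rw [norm_mul, norm_mul, mul_assoc]
    gcongr
  · filter_upwards with ω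
    exact ((continuous_const.mul (hH.comp (Continuous.prodMk_left (l ω)))).mul
      continuous_const).continuousOn

/-- Fubini's theorem for two forms coupled by a continuous kernel. -/
theorem densityForm_densityForm {Ω' : Type*} [MeasurableSpace Ω'] {μ' : Measure Ω'}
    [SFinite μ] [SFinite μ'] {a' : Ω' → ℂ} {l' r' : Ω' → ℝ} {G : ℝ → ℝ → ℂ} {z y : ℝ → ℂ}
    (hb : 0 ≤ b) (ha : Integrable a μ)
    (hl : Measurable l) (hr : Measurable r) (hlb : ∀ᵐ ω ∂μ, l ω ∈ Icc 0 b)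
    (hrb : ∀ᵐ ω ∂μ, r ω ∈ Icc 0 b) (ha' : Integrable a' μ')
    (hl' : Measurable l') (hr' : Measurable r') (hlb' : ∀ᵐ ω ∂μ', l' ω ∈ Icc 0 b)
    (hrb' : ∀ᵐ ω ∂μ', r' ω ∈ Icc 0 b) (hG : Continuous (Function.uncurry G))
    (hz : ContinuousOn z (Icc 0 b)) (hy : ContinuousOn y (Icc 0 b)) :
    densityForm μ a l r (fun t => densityForm μ' a' l' r' z (G t)) y
      = densityForm μ' a' l' r' z (fun x => densityForm μ a l r (fun t => G t x) y) := by
  obtain ⟨A, hA⟩ := (isCompact_Icc.prod isCompact_Icc :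
    IsCompact (Icc (0 : ℝ) b ×ˢ Icc (0 : ℝ) b)).exists_bound_of_continuousOn hG.continuousOn
  have hone : ContinuousOn (fun _ : ℝ => (1 : ℂ)) (Icc 0 b) := continuousOn_const
  have i1 := densityForm_integrable hb ha hl hr hlb hrb hone hy
  have i2 := densityForm_integrable hb ha' hl' hr' hlb' hrb' hz hone
  have i3 : Integrable (fun p : Ω × Ω' => (a p.1 * 1 * y (r p.1)) * (a' p.2 * z (l' p.2) * 1)
      * G (l p.1) (r' p.2)) (μ.prod μ') := by
    refine (i1.mul_prod i2).mul_bdd (c := A) ?_ ?_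
    · exact (hG.measurable.comp ((hl.comp measurable_fst).prodMk
        (hr'.comp measurable_snd))).aestronglyMeasurable
    · have e1 : ∀ᵐ p ∂(μ.prod μ'), l p.1 ∈ Icc 0 b := Measure.quasiMeasurePreserving_fst.ae hlb
      have e2 : ∀ᵐ p ∂(μ.prod μ'), r' p.2 ∈ Icc 0 b :=
        Measure.quasiMeasurePreserving_snd.ae hrb'
      filter_upwards [e1, e2] with p h1 h2 using hA (l p.1, r' p.2) ⟨h1, h2⟩
  have key := integral_integral_swap
    (f := fun ω ω' => (a ω * 1 * y (r ω)) * (a' ω' * z (l' ω') * 1) * G (l ω) (r' ω')) i3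
  simp only [densityForm]
  convert key using 1
  · refine integral_congr_ae (Eventually.of_forall fun ω => ?_)
    simp only
    rw [mul_right_comm, ← integral_const_mul]
    refine integral_congr_ae (Eventually.of_forall fun ω' => ?_)
    simp only; ring
  · refine integral_congr_ae (Eventually.of_forall fun ω => ?_)
    simp only
    rw [← integral_const_mul]
    refine integral_congr_ae (Eventually.of_forall fun ω' => ?_)
    simp only; ring

/-- Uniqueness for the integral equation `y x = g x - ∫ a ω * H x (l ω) * y (r ω) ∂μ` with a small
kernel. -/
theorem eqOn_of_eq_sub_densityForm {H : ℝ → ℝ → ℂ} {g y y' : ℝ → ℂ} {h : ℝ} (hb : 0 ≤ b)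
    (ha : Integrable a μ)
    (hl : Measurable l) (hr : Measurable r) (hlb : ∀ᵐ ω ∂μ, l ω ∈ Icc 0 b)
    (hrb : ∀ᵐ ω ∂μ, r ω ∈ Icc 0 b) (hH : Continuous (Function.uncurry H))
    (hHb : ∀ x ∈ Icc 0 b, ∀ t ∈ Icc 0 b, ‖H x t‖ ≤ h) (hsmall : h * (∫ ω, ‖a ω‖ ∂μ) ≤ 1 / 2)
    (hy : ContinuousOn y (Icc 0 b)) (hy' : ContinuousOn y' (Icc 0 b))
    (e : ∀ x ∈ Icc 0 b, y x = g x - densityForm μ a l r (H x) y)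
    (e' : ∀ x ∈ Icc 0 b, y' x = g x - densityForm μ a l r (H x) y') : EqOn y y' (Icc 0 b) := by
  -- At a maximum point of `‖y - y'‖` the equation bounds this maximum by half of itself.
  obtain ⟨x₀, hx₀, hmax⟩ := isCompact_Icc.exists_isMaxOn (nonempty_Icc.2 hb)
    ((hy.sub hy').norm)
  have hle : ∀ x ∈ Icc 0 b, ‖y x - y' x‖ ≤ ‖y x₀ - y' x₀‖ := fun x hx => hmax hx
  have h1 : ‖y x₀ - y' x₀‖ ≤ h * (∫ ω, ‖a ω‖ ∂μ) * ‖y x₀ - y' x₀‖ := by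
    have : y x₀ - y' x₀ = -densityForm μ a l r (H x₀) (fun x => y x - y' x) := by
      rw [densityForm_sub_right hb ha hl hr hlb hrb
        (hH.uncurry_left x₀).continuousOn hy hy', e _ hx₀, e' _ hx₀]
      ring
    conv_lhs => rw [this, norm_neg]
    exact norm_densityForm_le ha hlb hrb (hHb x₀ hx₀) hle
  have h2 : ‖y x₀ - y' x₀‖ = 0 := by
    nlinarith [norm_nonneg (y x₀ - y' x₀)]
  intro x hx
  have := hle x hx
  rw [h2] at this
  exact sub_eq_zero.1 (norm_le_zero_iff.1 this)

/-- Existence for the same integral equation, with an estimate of `y - g`. -/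
theorem exists_eq_sub_densityForm {H : ℝ → ℝ → ℂ} {g : ℝ → ℂ} {h C : ℝ} (hb : 0 ≤ b)
    (ha : Integrable a μ)
    (hl : Measurable l) (hr : Measurable r) (hlb : ∀ᵐ ω ∂μ, l ω ∈ Icc 0 b)
    (hrb : ∀ᵐ ω ∂μ, r ω ∈ Icc 0 b) (hH : Continuous (Function.uncurry H))
    (hHb : ∀ x ∈ Icc 0 b, ∀ t ∈ Icc 0 b, ‖H x t‖ ≤ h) (hsmall : h * (∫ ω, ‖a ω‖ ∂μ) ≤ 1 / 2)
    (hg : ContinuousOn g (Icc 0 b)) (hgC : ∀ x ∈ Icc 0 b, ‖g x‖ ≤ C) :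
    ∃ y : ℝ → ℂ, ContinuousOn y (Icc 0 b) ∧
      (∀ x ∈ Icc 0 b, y x = g x - densityForm μ a l r (H x) y) ∧
      ∀ x ∈ Icc 0 b, ‖y x - g x‖ ≤ 2 * (h * ∫ ω, ‖a ω‖ ∂μ) * C := by
  set A := ∫ ω, ‖a ω‖ ∂μ with hA
  have hA0 : 0 ≤ A := integral_nonneg fun _ => norm_nonneg _
  have h0b : (0 : ℝ) ∈ Icc 0 b := ⟨le_rfl, hb⟩
  have hh0 : 0 ≤ h := (norm_nonneg _).trans (hHb 0 h0b 0 h0b)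
  have hC0 : 0 ≤ C := (norm_nonneg _).trans (hgC 0 h0b)
  let ext : C(Icc (0 : ℝ) b, ℂ) → ℝ → ℂ := fun y => IccExtend hb y
  have hext : ∀ y : C(Icc (0 : ℝ) b, ℂ), ContinuousOn (ext y) (Icc 0 b) :=
    fun y => (y.continuous.Icc_extend').continuousOn
  let F : C(Icc (0 : ℝ) b, ℂ) → C(Icc (0 : ℝ) b, ℂ) := fun y =>
    ⟨(Icc 0 b).domRestrict (fun x => g x - densityForm μ a l r (H x) (ext y)),
      (hg.sub (continuousOn_densityForm hb ha hl hr hlb hrb hH (hext y))).domRestrict⟩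
  have hF : ∀ y (x : Icc (0 : ℝ) b), F y x = g x - densityForm μ a l r (H x) (ext y) :=
    fun _ _ => rfl
  have hcontr : ContractingWith (1 / 2) F := by
    refine ⟨by norm_num, LipschitzWith.of_dist_le_mul fun y y' => ?_⟩
    have hK : ((1 / 2 : NNReal) : ℝ) = 1 / 2 := by norm_num
    rw [hK, ContinuousMap.dist_le (by positivity)]
    intro x
    rw [dist_eq_norm, hF, hF]
    have e : g x - densityForm μ a l r (H x) (ext y) - (g x - densityForm μ a l r (H x) (ext y'))
        = -densityForm μ a l r (H x) (fun x => ext y x - ext y' x) := by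
      rw [densityForm_sub_right hb ha hl hr hlb hrb
        (hH.uncurry_left (x : ℝ)).continuousOn (hext y) (hext y')]
      ring
    rw [e, norm_neg]
    refine (norm_densityForm_le ha hlb hrb (hHb x x.2) (B := dist y y') ?_).trans ?_
    · intro t ht
      simp only [ext]
      rw [IccExtend_of_mem hb _ ht, IccExtend_of_mem hb _ ht, ← dist_eq_norm]
      exact ContinuousMap.dist_apply_le_dist _
    · gcongr
  set y := hcontr.fixedPoint F with hy
  have hfix : F y = y := hcontr.fixedPoint_isFixedPt
  have heq : ∀ x ∈ Icc 0 b, ext y x = g x - densityForm μ a l r (H x) (ext y) := by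
    intro x hx
    conv_lhs => simp only [ext]; rw [IccExtend_of_mem hb _ hx, ← hfix, hF]
  refine ⟨ext y, hext y, heq, ?_⟩
  obtain ⟨x₀, hx₀, hmax⟩ := isCompact_Icc.exists_isMaxOn (nonempty_Icc.2 hb) (hext y).norm
  have hle : ∀ x ∈ Icc 0 b, ‖ext y x‖ ≤ ‖ext y x₀‖ := fun x hx => hmax hx
  have hT : ∀ x ∈ Icc 0 b, ‖densityForm μ a l r (H x) (ext y)‖ ≤ h * A * ‖ext y x₀‖ :=
    fun x hx => norm_densityForm_le ha hlb hrb (hHb x hx) hle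
  -- Because `h * A ≤ 1 / 2`, the perturbation term is absorbed on the left; this produces the
  -- factor `2` in the final estimate.
  have hb2 : ‖ext y x₀‖ ≤ 2 * C := by
    have h1 : ‖ext y x₀‖ ≤ C + h * A * ‖ext y x₀‖ := by
      conv_lhs => rw [heq x₀ hx₀]
      exact (norm_sub_le _ _).trans (add_le_add (hgC _ hx₀) (hT _ hx₀))
    nlinarith [norm_nonneg (ext y x₀)]
  intro x hx
  rw [heq x hx, sub_sub_cancel_left, norm_neg]
  refine (hT x hx).trans ?_
  have : 0 ≤ h * A := by positivity
  nlinarith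

theorem continuousOn_densityForm_right {H : ℝ → ℝ → ℂ} {z : ℝ → ℂ} (hb : 0 ≤ b)
    (ha : Integrable a μ)
    (hl : Measurable l) (hr : Measurable r) (hlb : ∀ᵐ ω ∂μ, l ω ∈ Icc 0 b)
    (hrb : ∀ᵐ ω ∂μ, r ω ∈ Icc 0 b) (hH : Continuous (Function.uncurry H))
    (hz : ContinuousOn z (Icc 0 b)) :
    ContinuousOn (fun x => densityForm μ a l r z (H x)) (Icc 0 b) := by
  simp only [densityForm_swap z]
  exact continuousOn_densityForm hb ha hr hl hrb hlb hH hz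

/-- If `y` and `yt` solve the integral equations of two forms that differ by a third form, then
the corresponding boundary terms differ by the third form evaluated at `yt` and at a solution `z`
of the transposed equation. -/
theorem densityForm_sub_densityForm_eq {Ω' : Type*} [MeasurableSpace Ω'] {μ' : Measure Ω'}
    [SFinite μ] [SFinite μ'] {at' : Ω → ℂ} {a' : Ω' → ℂ} {l' r' : Ω' → ℝ} {G : ℝ → ℝ → ℂ}
    {P z y yt : ℝ → ℂ}
    (hb : 0 ≤ b) (ha : Integrable a μ)
    (hl : Measurable l) (hr : Measurable r) (hlb : ∀ᵐ ω ∂μ, l ω ∈ Icc 0 b)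
    (hrb : ∀ᵐ ω ∂μ, r ω ∈ Icc 0 b) (ha' : Integrable a' μ')
    (hl' : Measurable l') (hr' : Measurable r') (hlb' : ∀ᵐ ω ∂μ', l' ω ∈ Icc 0 b)
    (hrb' : ∀ᵐ ω ∂μ', r' ω ∈ Icc 0 b) (hG : Continuous (Function.uncurry G))
    (hsymm : ∀ x t, G x t = G t x)
    (hform : ∀ u v : ℝ → ℂ, ContinuousOn u (Icc 0 b) → ContinuousOn v (Icc 0 b) →
      densityForm μ a l r u v = densityForm μ at' l r u v + densityForm μ' a' l' r' u v)
    (hP : ContinuousOn P (Icc 0 b)) (hz : ContinuousOn z (Icc 0 b))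
    (hy : ContinuousOn y (Icc 0 b)) (hyt : ContinuousOn yt (Icc 0 b))
    (ez : ∀ x ∈ Icc 0 b, z x = P x - densityForm μ a l r z (G x))
    (ey : ∀ x ∈ Icc 0 b, y x = P x - densityForm μ a l r (G x) y)
    (eyt : ∀ x ∈ Icc 0 b, yt x = P x - densityForm μ at' l r (G x) yt) :
    densityForm μ a l r P y - densityForm μ at' l r P yt = densityForm μ' a' l' r' z yt := by
  have hGx : ∀ x, ContinuousOn (G x) (Icc 0 b) := fun x => (hG.uncurry_left x).continuousOn
  have hd : ContinuousOn (fun x => y x - yt x) (Icc 0 b) := hy.sub hyt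
  have hBz := continuousOn_densityForm_right hb ha hl hr hlb hrb hG hz
  have hbyt := continuousOn_densityForm hb ha' hl' hr' hlb' hrb' hG hyt
  have hflip : ∀ x, (fun t => G t x) = G x := fun x => funext fun t => hsymm t x
  have s1 := densityForm_sub_right hb ha hl hr hlb hrb hP hy hyt
  -- With `B`, `B̃`, `β = B - B̃` for the three forms and `d = y - yt`, the equation of `z` is
  -- inserted in `B(z, d)`, and Fubini moves `G` onto `d`.
  have s2 : densityForm μ a l r z (fun x => y x - yt x)
      = densityForm μ a l r P (fun x => y x - yt x)
        - densityForm μ a l r z (fun x => densityForm μ a l r (G x) (fun x => y x - yt x)) := by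
    have := densityForm_densityForm hb ha hl hr hlb hrb ha hl hr hlb hrb hG hz hd
    simp only [hflip] at this
    rw [densityForm_congr (z' := fun x => P x - densityForm μ a l r z (G x)) hlb hrb ez
      (fun x _ => rfl), densityForm_sub_left hb ha hl hr hlb hrb hP hBz hd, this]
  have s3 : densityForm μ' a' l' r' z yt = densityForm μ' a' l' r' P yt
      - densityForm μ a l r z (fun x => densityForm μ' a' l' r' (G x) yt) := by
    have := densityForm_densityForm hb ha' hl' hr' hlb' hrb' ha hl hr hlb hrb hG hz hyt
    simp only [hflip] at this
    rw [densityForm_congr (z' := fun x => P x - densityForm μ a l r z (G x)) hlb' hrb' ez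
      (fun x _ => rfl), densityForm_sub_left hb ha' hl' hr' hlb' hrb' hP hBz hyt, this]
  -- Subtracting the equations of `y` and `yt` gives `B(G x, d) = -d x - β(G x, yt)`. With `s2` this
  -- yields `B(P, d) = -B(z, β(G, yt))`, which by `s3` is `β(z, yt) - β(P, yt)`.
  have s4 : densityForm μ a l r z (fun x => densityForm μ a l r (G x) (fun x => y x - yt x))
      = densityForm μ a l r z (fun x => yt x - y x)
        - densityForm μ a l r z (fun x => densityForm μ' a' l' r' (G x) yt) := by
    have hd' : ContinuousOn (fun x => yt x - y x) (Icc 0 b) := hyt.sub hy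
    rw [← densityForm_sub_right hb ha hl hr hlb hrb hz hd' hbyt]
    refine densityForm_congr hlb hrb (fun x _ => rfl) fun x hx => ?_
    rw [densityForm_sub_right hb ha hl hr hlb hrb (hGx x) hy hyt, ey x hx, eyt x hx,
      hform _ _ (hGx x) hyt]
    ring
  have s5 := densityForm_sub_right hb ha hl hr hlb hrb hz hy hyt
  have s6 := densityForm_sub_right hb ha hl hr hlb hrb hz hyt hy
  have s7 := hform P yt hP hyt
  linear_combination -s1 - s2 - s3 + s4 + s5 + s6 + s7

/-- A solution of the transposed equation with exponential weight, for a density supported in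
`r ≤ l`. -/
theorem exists_eq_sub_densityForm_left_of_le {c : ℂ} (hc : c.re ≤ 0) {G : ℝ → ℝ → ℂ} {P : ℝ → ℂ}
    {h C : ℝ} (hb : 0 ≤ b) (ha : Integrable a μ)
    (hl : Measurable l) (hr : Measurable r) (hlb : ∀ᵐ ω ∂μ, l ω ∈ Icc 0 b)
    (hrb : ∀ᵐ ω ∂μ, r ω ∈ Icc 0 b) (hrl : ∀ᵐ ω ∂μ, r ω ≤ l ω)
    (hG : Continuous (Function.uncurry G))
    (hGb : ∀ x ∈ Icc 0 b, ∀ t ∈ Icc 0 b,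
      ‖Complex.exp (c * (t - x : ℝ)) * G x t‖ ≤ h)
    (hsmall : h * (∫ ω, ‖a ω‖ ∂μ) ≤ 1 / 2)
    (hP : ContinuousOn P (Icc 0 b)) (hPC : ∀ x ∈ Icc 0 b, ‖P x‖ ≤ C * Real.exp (c.re * x)) :
    ∃ z : ℝ → ℂ, ContinuousOn z (Icc 0 b) ∧
      (∀ x ∈ Icc 0 b, z x = P x - densityForm μ a l r z (G x)) ∧
      ∀ x ∈ Icc 0 b, ‖z x - P x‖ ≤ 2 * (h * ∫ ω, ‖a ω‖ ∂μ) * C * Real.exp (c.re * x) := by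
  have h0b : (0 : ℝ) ∈ Icc 0 b := ⟨le_rfl, hb⟩
  have hh0 : 0 ≤ h := (norm_nonneg _).trans (hGb 0 h0b 0 h0b)
  have nexp : ∀ x : ℝ, ‖Complex.exp (c * x)‖ = Real.exp (c.re * x) := fun x => by
    rw [Complex.norm_exp]; simp
  have nexp' : ∀ x : ℝ, ‖Complex.exp (-(c * x))‖ = Real.exp (-(c.re * x)) := fun x => by
    rw [Complex.norm_exp]; simp
  have hE : ∀ x : ℝ, Complex.exp (c * x) * Complex.exp (-(c * x)) = 1 := fun x => by
    rw [← Complex.exp_add]; simp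
  -- Substituting `z = exp(cx) w` splits the weight `exp(c(l - x))` into `exp(c(l - r))`, put into
  -- the density, and `exp(c(r - x))`, put into the kernel. The first has modulus at most one
  -- exactly because `r ≤ l` and `Re c ≤ 0`.
  set a' : Ω → ℂ := fun ω => a ω * Complex.exp (c * (l ω - r ω : ℝ)) with ha'
  have hbd : ∀ᵐ ω ∂μ, ‖Complex.exp (c * (l ω - r ω : ℝ))‖ ≤ 1 := by
    filter_upwards [hrl] with ω hω
    rw [nexp, Real.exp_le_one_iff]
    exact mul_nonpos_of_nonpos_of_nonneg hc (sub_nonneg.2 hω)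
  have ha'i : Integrable a' μ := by
    refine ha.mul_bdd (c := 1) ?_ hbd
    exact Measurable.aestronglyMeasurable (by fun_prop)
  have hle : ∫ ω, ‖a' ω‖ ∂μ ≤ ∫ ω, ‖a ω‖ ∂μ := by
    refine integral_mono_ae ha'i.norm ha.norm ?_
    filter_upwards [hbd] with ω hω
    rw [ha', norm_mul]
    exact mul_le_of_le_one_right (norm_nonneg _) hω
  obtain ⟨w, hw, hweq, hwb⟩ := exists_eq_sub_densityForm (μ := μ) (a := a') (l := r) (r := l)
    (H := fun x t => Complex.exp (c * (t - x : ℝ)) * G x t)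
    (g := fun x => Complex.exp (-(c * x)) * P x) (C := C) hb ha'i hr hl hrb hlb
    (by
      have h1 : Continuous (fun p : ℝ × ℝ => Complex.exp (c * (p.2 - p.1 : ℝ))) := by fun_prop
      exact h1.mul hG) hGb
    ((mul_le_mul_of_nonneg_left hle hh0).trans hsmall)
    (ContinuousOn.mul (by fun_prop) hP)
    (fun x hx => by
      rw [norm_mul, nexp']
      calc _ ≤ Real.exp (-(c.re * x)) * (C * Real.exp (c.re * x)) := by
            gcongr; exact hPC x hx
        _ = C * (Real.exp (-(c.re * x)) * Real.exp (c.re * x)) := by ring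
        _ = C := by rw [← Real.exp_add]; simp)
  have hC0 : 0 ≤ C := by
    have := (norm_nonneg _).trans (hPC 0 h0b)
    simpa using this
  refine ⟨fun x => Complex.exp (c * x) * w x, ContinuousOn.mul (by fun_prop) hw,
    fun x hx => ?_, fun x hx => ?_⟩
  · simp only
    rw [hweq x hx, mul_sub, ← mul_assoc, hE, one_mul]
    congr 1
    simp only [densityForm]
    rw [← integral_const_mul]
    refine integral_congr_ae (Eventually.of_forall fun ω => ?_)
    have e : Complex.exp (c * x) * (Complex.exp (c * (l ω - r ω : ℝ))
        * Complex.exp (c * (r ω - x : ℝ))) = Complex.exp (c * l ω) := by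
      rw [← Complex.exp_add, ← Complex.exp_add]; congr 1; push_cast; ring
    simp only [ha']
    rw [← e]; ring
  · have e : Complex.exp (c * x) * w x - P x
        = Complex.exp (c * x) * (w x - Complex.exp (-(c * x)) * P x) := by
      linear_combination (P x) * hE x
    rw [e, norm_mul, nexp, mul_comm]
    gcongr
    refine (hwb x hx).trans ?_
    gcongr

end densityForm

end

noncomputable section

/-! ### The boundary value problem `y'' + ρ² y = f`, `y 0 = 1`, `y b = 0` -/

/-- The Green function of `y'' + ρ² y` on `[0, b]` with Dirichlet conditions, up to sign. -/
def greenKernel (ρ : ℂ) (b x t : ℝ) : ℂ :=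
  Complex.sin (ρ * (min x t : ℝ)) * Complex.sin (ρ * (b - max x t : ℝ))
    / (ρ * Complex.sin (ρ * b))

/-- The solution of `y'' + ρ² y = 0` with `y 0 = 1` and `y b = 0`. -/
def freeSolution (ρ : ℂ) (b x : ℝ) : ℂ :=
  Complex.sin (ρ * (b - x : ℝ)) / Complex.sin (ρ * b)

theorem greenKernel_comm (ρ : ℂ) (b x t : ℝ) : greenKernel ρ b x t = greenKernel ρ b t x := by
  rw [greenKernel, greenKernel, min_comm, max_comm]

theorem continuous_greenKernel (ρ : ℂ) (b : ℝ) :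
    Continuous (Function.uncurry (greenKernel ρ b)) := by
  unfold greenKernel Function.uncurry
  fun_prop

theorem continuous_freeSolution (ρ : ℂ) (b : ℝ) : Continuous (freeSolution ρ b) := by
  unfold freeSolution
  fun_prop

theorem hasDerivAt_sin_mul_ofReal (ρ : ℂ) (x : ℝ) :
    HasDerivAt (fun t : ℝ => Complex.sin (ρ * t)) (ρ * Complex.cos (ρ * x)) x := by
  have h := ((hasDerivAt_id (x : ℂ)).const_mul ρ).csin.comp_ofReal
  simpa [mul_comm] using h

theorem hasDerivAt_cos_mul_ofReal (ρ : ℂ) (x : ℝ) :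
    HasDerivAt (fun t : ℝ => Complex.cos (ρ * t)) (-(ρ * Complex.sin (ρ * x))) x := by
  have h := ((hasDerivAt_id (x : ℂ)).const_mul ρ).ccos.comp_ofReal
  simpa [mul_comm] using h

theorem hasDerivAt_sin_mul_sub_ofReal (ρ : ℂ) (b x : ℝ) :
    HasDerivAt (fun t : ℝ => Complex.sin (ρ * (b - t : ℝ)))
      (-(ρ * Complex.cos (ρ * (b - x : ℝ)))) x :=
  ((hasDerivAt_sin_mul_ofReal ρ (b - x)).scomp x ((hasDerivAt_id x).const_sub b)).congr_deriv
    (by simp)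

theorem hasDerivAt_neg_mul_cos_mul_sub_ofReal (ρ : ℂ) (b x : ℝ) :
    HasDerivAt (fun t : ℝ => -(ρ * Complex.cos (ρ * (b - t : ℝ))))
      (-(ρ ^ 2 * Complex.sin (ρ * (b - x : ℝ)))) x :=
  (((hasDerivAt_cos_mul_ofReal ρ (b - x)).scomp x
    ((hasDerivAt_id x).const_sub b)).const_mul ρ).fun_neg.congr_deriv (by simp; ring)

theorem hasDerivAt_cexp_mul_ofReal (c : ℂ) (x : ℝ) :
    HasDerivAt (fun t : ℝ => Complex.exp (c * t)) (c * Complex.exp (c * x)) x := by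
  have h := ((hasDerivAt_id (x : ℂ)).const_mul c).cexp.comp_ofReal
  simpa [mul_comm] using h

/-- The system `y' = y₁`, `y₁' = f - ρ² y` in the sense of Carathéodory on `[0, b]`. -/
structure IsForcedSolution (ρ : ℂ) (b : ℝ) (f y y₁ : ℝ → ℂ) : Prop where
  hasDerivWithinAt : ∀ x ∈ Icc 0 b, HasDerivWithinAt y (y₁ x) (Icc 0 b) x
  absolutelyContinuous : AbsolutelyContinuousOnInterval y₁ 0 b
  ode : ∀ᵐ x, x ∈ Icc 0 b → HasDerivAt y₁ (f x - ρ ^ 2 * y x) x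

namespace IsForcedSolution

variable {ρ : ℂ} {b : ℝ} {f y y₁ : ℝ → ℂ}

theorem continuousOn (h : IsForcedSolution ρ b f y y₁) : ContinuousOn y (Icc 0 b) :=
  fun x hx => (h.hasDerivWithinAt x hx).continuousWithinAt

theorem absolutelyContinuous_fst (hb : 0 < b) (h : IsForcedSolution ρ b f y y₁) :
    AbsolutelyContinuousOnInterval y 0 b := by
  refine ContDiffOn.absolutelyContinuousOnInterval ?_
  rw [uIcc_of_le hb.le]
  have hc := h.absolutelyContinuous.continuousOn
  rw [uIcc_of_le hb.le] at hc
  refine (contDiffOn_one_iff_derivWithin (uniqueDiffOn_Icc hb)).2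
    ⟨fun x hx => (h.hasDerivWithinAt x hx).differentiableWithinAt, hc.congr fun x hx => ?_⟩
  exact (h.hasDerivWithinAt x hx).derivWithin (uniqueDiffOn_Icc hb x hx)

theorem ae_hasDerivAt (h : IsForcedSolution ρ b f y y₁) :
    ∀ᵐ x, x ∈ Icc 0 b → HasDerivAt y (y₁ x) x := by
  have h0 : ∀ᵐ x : ℝ, x ≠ 0 := by simp [ae_iff, measure_singleton]
  have h1 : ∀ᵐ x : ℝ, x ≠ b := by simp [ae_iff, measure_singleton]
  filter_upwards [h0, h1] with x hx0 hxb hx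
  exact (h.hasDerivWithinAt x hx).hasDerivAt
    (Icc_mem_nhds (lt_of_le_of_ne hx.1 (Ne.symm hx0)) (lt_of_le_of_ne hx.2 hxb))

/-- The Lagrange identity. -/
theorem integral_mul_eq (hb : 0 < b) (h : IsForcedSolution ρ b f y y₁) {g g₁ : ℝ → ℂ}
    (hg : ∀ x, HasDerivAt g (g₁ x) x) (hg₁ : ∀ x, HasDerivAt g₁ (-(ρ ^ 2 * g x)) x)
    {c d : ℝ} (hc : 0 ≤ c) (hcd : c ≤ d) (hd : d ≤ b) :
    ∫ x in c..d, g x * f x = (y₁ d * g d - y d * g₁ d) - (y₁ c * g c - y c * g₁ c) := by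
  have smooth : ∀ {u u' : ℝ → ℂ}, (∀ x, HasDerivAt u (u' x) x) → Continuous u' →
      AbsolutelyContinuousOnInterval u 0 b := by
    intro u u' hu hu'
    refine (ContDiff.contDiffOn ?_).absolutelyContinuousOnInterval
    rw [contDiff_one_iff_deriv]
    exact ⟨fun x => (hu x).differentiableAt, by rwa [deriv_eq hu]⟩
  have gc : Continuous g := continuous_iff_continuousAt.2 fun x => (hg x).continuousAt
  have g1c : Continuous g₁ := continuous_iff_continuousAt.2 fun x => (hg₁ x).continuousAt
  have hgac := smooth hg g1c
  have hg1ac := smooth hg₁ (by fun_prop)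
  have hsub : uIcc c d ⊆ uIcc 0 b := by
    rw [uIcc_of_le hcd, uIcc_of_le hb.le]; exact Icc_subset_Icc hc hd
  -- The Wronskian `y₁ g - y g₁` has derivative `g f` almost everywhere, the `ρ²` terms cancelling.
  have hW := ((h.absolutelyContinuous.fun_smul hgac).fun_sub
    ((h.absolutelyContinuous_fst hb).fun_smul hg1ac)).mono hsub
  refine hW.integral_eq_sub_of_ae_hasDerivAt ?_
  filter_upwards [h.ae_hasDerivAt, h.ode] with x h1 h2 hx
  have hx' : x ∈ Icc 0 b := by simpa [uIcc_of_le hb.le] using hsub hx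
  exact (((h2 hx').fun_mul (hg x)).fun_sub ((h1 hx').fun_mul (hg₁ x))).congr_deriv (by ring)

/-- The Lagrange identity is used on `[0, x]` with `sin ρt` and on `[x, b]` with `sin ρ(b - t)`.
Weighting these by `sin ρ(b - x)` and `sin ρx` eliminates `y₁ x`, and the addition formula leaves
`sin ρb` in front of `y x`. -/
theorem eq_freeSolution_sub (hb : 0 < b) (h : IsForcedSolution ρ b f y y₁) (hρ : ρ ≠ 0)
    (hs : Complex.sin (ρ * b) ≠ 0) (hf : IntervalIntegrable f volume 0 b) (h0 : y 0 = 1)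
    (h1 : y b = 0) {x : ℝ} (hx : x ∈ Icc 0 b) :
    y x = freeSolution ρ b x - ∫ t in 0..b, greenKernel ρ b x t * f t := by
  have hg : ∀ x : ℝ, HasDerivAt (fun t : ℝ => Complex.sin (ρ * t)) (ρ * Complex.cos (ρ * x)) x :=
    hasDerivAt_sin_mul_ofReal ρ
  have hg1 : ∀ x : ℝ, HasDerivAt (fun t : ℝ => ρ * Complex.cos (ρ * t))
      (-(ρ ^ 2 * Complex.sin (ρ * x))) x := fun x =>
    ((hasDerivAt_cos_mul_ofReal ρ x).const_mul ρ).congr_deriv (by ring)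
  have e1 := h.integral_mul_eq hb hg hg1 le_rfl hx.1 hx.2
  have k := hasDerivAt_sin_mul_sub_ofReal ρ b
  have k1 := hasDerivAt_neg_mul_cos_mul_sub_ofReal ρ b
  have e2 := h.integral_mul_eq hb k k1 hx.1 hx.2 le_rfl
  have hGc : Continuous (greenKernel ρ b x) := (continuous_greenKernel ρ b).uncurry_left x
  have hi : IntervalIntegrable (fun t => greenKernel ρ b x t * f t) volume 0 b :=
    hf.continuousOn_mul hGc.continuousOn
  have hx0b : x ∈ uIcc 0 b := by rwa [uIcc_of_le hb.le]
  rw [← intervalIntegral.integral_add_adjacent_intervals (b := x)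
    (hi.mono_set (uIcc_subset_uIcc left_mem_uIcc hx0b))
    (hi.mono_set (uIcc_subset_uIcc hx0b right_mem_uIcc))]
  have f1 : ∫ t in 0..x, greenKernel ρ b x t * f t
      = Complex.sin (ρ * (b - x : ℝ)) / (ρ * Complex.sin (ρ * b))
        * ∫ t in 0..x, Complex.sin (ρ * t) * f t := by
    rw [← intervalIntegral.integral_const_mul]
    refine intervalIntegral.integral_congr fun t ht => ?_
    rw [uIcc_of_le hx.1] at ht
    simp only [greenKernel]
    rw [min_eq_right ht.2, max_eq_left ht.2]; ring
  have f2 : ∫ t in x..b, greenKernel ρ b x t * f t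
      = Complex.sin (ρ * x) / (ρ * Complex.sin (ρ * b))
        * ∫ t in x..b, Complex.sin (ρ * (b - t : ℝ)) * f t := by
    rw [← intervalIntegral.integral_const_mul]
    refine intervalIntegral.integral_congr fun t ht => ?_
    rw [uIcc_of_le hx.2] at ht
    simp only [greenKernel]
    rw [min_eq_left ht.1, max_eq_right ht.1]; ring
  have hadd : Complex.sin (ρ * b) = Complex.sin (ρ * x) * Complex.cos (ρ * (b - x : ℝ))
      + Complex.cos (ρ * x) * Complex.sin (ρ * (b - x : ℝ)) := by
    rw [← Complex.sin_add]; congr 1; push_cast; ring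
  rw [f1, f2, e1, e2, h0, h1, freeSolution]
  have hne : ρ * Complex.sin (ρ * b) ≠ 0 := mul_ne_zero hρ hs
  simp only [Complex.ofReal_zero, mul_zero, Complex.sin_zero, Complex.cos_zero, sub_self]
  field_simp
  rw [hadd]
  ring

theorem deriv_zero_eq (hb : 0 < b) (h : IsForcedSolution ρ b f y y₁)
    (hs : Complex.sin (ρ * b) ≠ 0) (h0 : y 0 = 1) (h1 : y b = 0) :
    y₁ 0 = -(ρ * Complex.cos (ρ * b) / Complex.sin (ρ * b))
      - ∫ t in 0..b, freeSolution ρ b t * f t := by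
  have k := hasDerivAt_sin_mul_sub_ofReal ρ b
  have k1 := hasDerivAt_neg_mul_cos_mul_sub_ofReal ρ b
  have e := h.integral_mul_eq hb k k1 le_rfl hb.le le_rfl
  have f1 : ∫ t in 0..b, freeSolution ρ b t * f t
      = (Complex.sin (ρ * b))⁻¹ * ∫ t in 0..b, Complex.sin (ρ * (b - t : ℝ)) * f t := by
    rw [← intervalIntegral.integral_const_mul]
    refine intervalIntegral.integral_congr fun t ht => ?_
    simp only [freeSolution]; ring
  rw [f1, e, h0, h1]
  simp only [sub_self, sub_zero, Complex.ofReal_zero, mul_zero, Complex.sin_zero]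
  field_simp
  ring

end IsForcedSolution

/-- Variation of constants, via the factorization `D² + ρ² = (D + iρ)(D - iρ)`. -/
theorem exists_isForcedSolution {ρ : ℂ} {b : ℝ} {f : ℝ → ℂ} (hb : 0 < b)
    (hs : Complex.sin (ρ * b) ≠ 0) (hf : IntervalIntegrable f volume 0 b) :
    ∃ y y₁, IsForcedSolution ρ b f y y₁ ∧ y 0 = 1 ∧ y b = 0 := by
  set c : ℂ := Complex.I * ρ with hc
  have hcc : c * c = -ρ ^ 2 := by rw [hc]; linear_combination ρ ^ 2 * Complex.I_mul_I
  have expac : ∀ c : ℂ, AbsolutelyContinuousOnInterval (fun t : ℝ => Complex.exp (c * t)) 0 b := by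
    intro c
    refine (ContDiff.contDiffOn ?_).absolutelyContinuousOnInterval
    exact (contDiff_const.mul Complex.ofRealCLM.contDiff).cexp
  have expinv : ∀ x : ℝ, Complex.exp (-c * x) * Complex.exp (c * x) = 1 := fun x => by
    rw [← Complex.exp_add]; simp
  have hi : IntervalIntegrable (fun t : ℝ => Complex.exp (c * t) * f t) volume 0 b :=
    hf.continuousOn_mul (by fun_prop)
  -- First-order problems are solved in turn: `w' + c w = f` almost everywhere, then `v' - c v = w`
  -- everywhere, as `w` is continuous. Hence `v'' = c² v + f`.
  let w : ℝ → ℂ := fun x => Complex.exp (-c * x) * ∫ t in 0..x, Complex.exp (c * t) * f t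
  have hwac : AbsolutelyContinuousOnInterval w 0 b :=
    (expac (-c)).fun_smul hi.absolutelyContinuousOnInterval_complex
  have hw : ∀ᵐ x, x ∈ Icc 0 b → HasDerivAt w (f x - c * w x) x := by
    filter_upwards [hi.ae_hasDerivAt_integral] with x hx hxm
    rw [← uIcc_of_le hb.le] at hxm
    refine ((hasDerivAt_cexp_mul_ofReal (-c) x).fun_mul (hx hxm 0 (by simp))).congr_deriv ?_
    simp only [w]
    linear_combination (f x) * expinv x
  have hwc : ContinuousOn w (Icc 0 b) := by
    simpa [uIcc_of_le hb.le] using hwac.continuousOn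
  have hi2 : ContinuousOn (fun t : ℝ => Complex.exp (-c * t) * w t) (Icc 0 b) :=
    ContinuousOn.mul (by fun_prop) hwc
  let v : ℝ → ℂ := fun x => Complex.exp (c * x) * ∫ t in 0..x, Complex.exp (-c * t) * w t
  have hv : ∀ x ∈ Icc 0 b, HasDerivWithinAt v (c * v x + w x) (Icc 0 b) x := by
    intro x hx
    have hFTC : HasDerivWithinAt (fun x => ∫ t in 0..x, Complex.exp (-c * t) * w t)
        (Complex.exp (-c * x) * w x) (Icc 0 b) x := by
      have : Fact (x ∈ Icc 0 b) := ⟨hx⟩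
      refine intervalIntegral.integral_hasDerivWithinAt_right
        ((hi2.mono (Icc_subset_Icc le_rfl hx.2)).intervalIntegrable_of_Icc hx.1) ?_ (hi2 x hx)
      exact hi2.stronglyMeasurableAtFilter_nhdsWithin measurableSet_Icc x
    refine ((hasDerivAt_cexp_mul_ofReal c x).hasDerivWithinAt.fun_mul hFTC).congr_deriv ?_
    simp only [v]
    linear_combination (w x) * expinv x
  have hsys : IsForcedSolution ρ b f v (fun x => c * v x + w x) := by
    have hvac : AbsolutelyContinuousOnInterval v 0 b :=
      (expac c).fun_smul (hi2.intervalIntegrable_of_Icc hb.le).absolutelyContinuousOnInterval_complex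
    refine ⟨hv, (hvac.const_smul c).fun_add hwac, ?_⟩
    have h0 : ∀ᵐ x : ℝ, x ≠ 0 := by simp [ae_iff, measure_singleton]
    have h1 : ∀ᵐ x : ℝ, x ≠ b := by simp [ae_iff, measure_singleton]
    filter_upwards [h0, h1, hw] with x hx0 hxb hwx hx
    have hvx := (hv x hx).hasDerivAt
      (Icc_mem_nhds (lt_of_le_of_ne hx.1 (Ne.symm hx0)) (lt_of_le_of_ne hx.2 hxb))
    refine ((hvx.const_mul c).fun_add (hwx hx)).congr_deriv ?_
    linear_combination v x * hcc
  have hv0 : v 0 = 0 := by simp [v]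
  -- Adding `cos ρx` fixes the value `1` at `0`; `κ` is then forced by the condition at `b`.
  set κ : ℂ := (-Complex.cos (ρ * b) - v b) / Complex.sin (ρ * b) with hκ
  refine ⟨fun x => v x + (Complex.cos (ρ * x) + κ * Complex.sin (ρ * x)),
    fun x => (c * v x + w x) + (-(ρ * Complex.sin (ρ * x)) + κ * (ρ * Complex.cos (ρ * x))),
    ⟨fun x hx => ?_, ?_, ?_⟩, by simp [hv0], ?_⟩
  · exact (hv x hx).add ((hasDerivAt_cos_mul_ofReal ρ x).add
      ((hasDerivAt_sin_mul_ofReal ρ x).const_mul κ)).hasDerivWithinAt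
  · refine hsys.absolutelyContinuous.fun_add
      (ContDiff.contDiffOn ?_).absolutelyContinuousOnInterval
    have hρx : ContDiff ℝ 1 (fun x : ℝ => ρ * (x : ℂ)) :=
      contDiff_const.mul Complex.ofRealCLM.contDiff
    exact (contDiff_const.mul ((Complex.contDiff_sin.restrict_scalars ℝ).comp hρx)).neg.add
      (contDiff_const.mul (contDiff_const.mul
        ((Complex.contDiff_cos.restrict_scalars ℝ).comp hρx)))
  · filter_upwards [hsys.ode] with x hx hxm
    exact ((hx hxm).fun_add (((hasDerivAt_sin_mul_ofReal ρ x).const_mul ρ).fun_neg.fun_add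
      (((hasDerivAt_cos_mul_ofReal ρ x).const_mul ρ).const_mul κ))).congr_deriv (by ring)
  · simp only [hκ]
    field_simp
    ring

end

noncomputable section

/-! ### The form of the integro-differential operator -/

/-- The triangle `0 ≤ t ≤ x ≤ π`. -/
def weylTriangle : Set (ℝ × ℝ) := {p | 0 ≤ p.2 ∧ p.2 ≤ p.1 ∧ p.1 ≤ Real.pi}

/-- Lebesgue measure on the disjoint union of `[0, π]` and the triangle. -/
def weylMeasure : Measure (ℝ ⊕ ℝ × ℝ) :=
  (volume.restrict (Icc 0 Real.pi)).map Sum.inl + (volume.restrict weylTriangle).map Sum.inr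

/-- The potential on `[0, π]` together with the kernel on the triangle. -/
def weylDensity (q : ℝ → ℂ) (M : ℝ → ℝ → ℂ) : ℝ ⊕ ℝ × ℝ → ℂ :=
  Sum.elim q (fun p => M p.1 p.2)

/-- The bilinear form `∫ q z y + ∫∫ M(x,t) z(x) y(t)`. -/
def weylForm (q : ℝ → ℂ) (M : ℝ → ℝ → ℂ) (z y : ℝ → ℂ) : ℂ :=
  densityForm weylMeasure (weylDensity q M) (Sum.elim id Prod.fst) (Sum.elim id Prod.snd) z y

/-- The function `q y + ∫₀ˣ M(x,t) y(t) dt`. -/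
def weylForcing (q : ℝ → ℂ) (M : ℝ → ℝ → ℂ) (y : ℝ → ℂ) (x : ℝ) : ℂ :=
  q x * y x + ∫ t in (0 : ℝ)..x, M x t * y t

instance : SFinite weylMeasure := by unfold weylMeasure; infer_instance

theorem measurableSet_weylTriangle : MeasurableSet weylTriangle :=
  (measurableSet_le measurable_const measurable_snd).inter
    ((measurableSet_le measurable_snd measurable_fst).inter
      (measurableSet_le measurable_fst measurable_const))

theorem measurableEmbedding_sum_inl {α β : Type*} [MeasurableSpace α] [MeasurableSpace β] :
    MeasurableEmbedding (Sum.inl : α → α ⊕ β) :=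
  ⟨Sum.inl_injective, measurable_inl, fun _ hs => hs.inl_image⟩

theorem measurableEmbedding_sum_inr {α β : Type*} [MeasurableSpace α] [MeasurableSpace β] :
    MeasurableEmbedding (Sum.inr : β → α ⊕ β) :=
  ⟨Sum.inr_injective, measurable_inr, fun _ hs => measurableSet_inr_image.2 hs⟩

theorem measurable_weylLeft : Measurable (Sum.elim id Prod.fst : ℝ ⊕ ℝ × ℝ → ℝ) :=
  measurable_id.sumElim measurable_fst

theorem measurable_weylRight : Measurable (Sum.elim id Prod.snd : ℝ ⊕ ℝ × ℝ → ℝ) :=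
  measurable_id.sumElim measurable_snd

theorem ae_weylMeasure {p : ℝ ⊕ ℝ × ℝ → Prop} (h1 : ∀ x ∈ Icc 0 Real.pi, p (Sum.inl x))
    (h2 : ∀ x ∈ weylTriangle, p (Sum.inr x)) : ∀ᵐ ω ∂weylMeasure, p ω := by
  rw [weylMeasure, ae_add_measure_iff, measurableEmbedding_sum_inl.ae_map_iff,
    measurableEmbedding_sum_inr.ae_map_iff]
  exact ⟨(ae_restrict_iff' measurableSet_Icc).2 (Eventually.of_forall h1),
    (ae_restrict_iff' measurableSet_weylTriangle).2 (Eventually.of_forall h2)⟩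

theorem ae_weylLeft_mem :
    ∀ᵐ ω ∂weylMeasure, (Sum.elim id Prod.fst : ℝ ⊕ ℝ × ℝ → ℝ) ω ∈ Icc 0 Real.pi :=
  ae_weylMeasure (fun _ hx => hx) fun _ hx => ⟨hx.1.trans hx.2.1, hx.2.2⟩

theorem ae_weylRight_mem :
    ∀ᵐ ω ∂weylMeasure, (Sum.elim id Prod.snd : ℝ ⊕ ℝ × ℝ → ℝ) ω ∈ Icc 0 Real.pi :=
  ae_weylMeasure (fun _ hx => hx) fun _ hx => ⟨hx.1, hx.2.1.trans hx.2.2⟩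

theorem ae_weylRight_le_weylLeft :
    ∀ᵐ ω ∂weylMeasure, (Sum.elim id Prod.snd : ℝ ⊕ ℝ × ℝ → ℝ) ω
      ≤ (Sum.elim id Prod.fst : ℝ ⊕ ℝ × ℝ → ℝ) ω :=
  ae_weylMeasure (fun _ _ => le_rfl) fun _ hx => hx.2.1

theorem integrable_weylMeasure_iff {F : ℝ ⊕ ℝ × ℝ → ℂ} :
    Integrable F weylMeasure ↔ IntegrableOn (fun x => F (Sum.inl x)) (Icc 0 Real.pi) ∧
      IntegrableOn (fun p => F (Sum.inr p)) weylTriangle := by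
  rw [weylMeasure, integrable_add_measure, measurableEmbedding_sum_inl.integrable_map_iff,
    measurableEmbedding_sum_inr.integrable_map_iff]
  rfl

theorem integral_weylMeasure {F : ℝ ⊕ ℝ × ℝ → ℂ} (hF : Integrable F weylMeasure) :
    ∫ ω, F ω ∂weylMeasure
      = (∫ x in Icc 0 Real.pi, F (Sum.inl x)) + ∫ p in weylTriangle, F (Sum.inr p) := by
  have h := integrable_add_measure.1 hF
  rw [weylMeasure, integral_add_measure h.1 h.2, measurableEmbedding_sum_inl.integral_map,
    measurableEmbedding_sum_inr.integral_map]

variable {q qt : ℝ → ℂ} {M : ℝ → ℝ → ℂ}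

theorem integrable_weylDensity (hq : ContinuousOn q (Icc 0 Real.pi))
    (hM : IntegrableOn (fun p : ℝ × ℝ => M p.1 p.2) weylTriangle) :
    Integrable (weylDensity q M) weylMeasure :=
  integrable_weylMeasure_iff.2 ⟨hq.integrableOn_Icc, hM⟩

theorem integral_indicator_weylTriangle (F : ℝ × ℝ → ℂ) (t : ℝ) :
    ∫ s, weylTriangle.indicator F (t, s)
      = (Icc 0 Real.pi).indicator (fun t => ∫ s in (0 : ℝ)..t, F (t, s)) t := by
  by_cases ht : t ∈ Icc 0 Real.pi
  · rw [indicator_of_mem ht, intervalIntegral.integral_of_le ht.1, ← integral_Icc_eq_integral_Ioc,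
      ← integral_indicator measurableSet_Icc]
    congr 1
    ext s
    by_cases hs : s ∈ Icc 0 t
    · rw [indicator_of_mem hs, indicator_of_mem (show (t, s) ∈ weylTriangle from
        ⟨hs.1, hs.2, ht.2⟩)]
    · rw [indicator_of_notMem hs, indicator_of_notMem (show (t, s) ∉ weylTriangle from
        fun h => hs ⟨h.1, h.2.1⟩)]
  · rw [indicator_of_notMem ht, ← integral_zero ℝ ℂ]
    congr 1
    ext s
    exact indicator_of_notMem (fun h => ht ⟨h.1.trans h.2.1, h.2.2⟩) _

theorem integrableOn_kernel_mul (hM : IntegrableOn (fun p : ℝ × ℝ => M p.1 p.2) weylTriangle)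
    {y : ℝ → ℂ} (hy : ContinuousOn y (Icc 0 Real.pi)) :
    IntegrableOn (fun p : ℝ × ℝ => M p.1 p.2 * y p.2) weylTriangle := by
  -- Zero potential and left factor `1` reduce the claim to the triangle component of a known
  -- integrability statement.
  have h := (integrable_weylMeasure_iff.1 (densityForm_integrable Real.pi_pos.le
    (integrable_weylDensity (q := fun _ => 0) continuousOn_const hM) measurable_weylLeft
    measurable_weylRight ae_weylLeft_mem ae_weylRight_mem
    (continuousOn_const (c := (1 : ℂ))) hy)).2
  simpa [weylDensity] using h

theorem intervalIntegrable_weylForcing (hq : ContinuousOn q (Icc 0 Real.pi))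
    (hM : IntegrableOn (fun p : ℝ × ℝ => M p.1 p.2) weylTriangle) {y : ℝ → ℂ}
    (hy : ContinuousOn y (Icc 0 Real.pi)) :
    IntervalIntegrable (weylForcing q M y) volume 0 Real.pi := by
  refine ((hq.mul hy).intervalIntegrable_of_Icc Real.pi_pos.le).add ?_
  rw [intervalIntegrable_iff_integrableOn_Icc_of_le Real.pi_pos.le]
  have h := ((integrable_indicator_iff measurableSet_weylTriangle).2
    (integrableOn_kernel_mul hM hy)).integral_prod_left
  simp only [integral_indicator_weylTriangle] at h
  exact (integrable_indicator_iff measurableSet_Icc).1 h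

/-- This links the differential equation, where the forcing appears, to the abstract form, where
transposition and Fubini are available. -/
theorem weylForm_eq_integral (hq : ContinuousOn q (Icc 0 Real.pi))
    (hM : IntegrableOn (fun p : ℝ × ℝ => M p.1 p.2) weylTriangle) {z y : ℝ → ℂ}
    (hz : ContinuousOn z (Icc 0 Real.pi)) (hy : ContinuousOn y (Icc 0 Real.pi)) :
    weylForm q M z y = ∫ t in (0 : ℝ)..Real.pi, z t * weylForcing q M y t := by
  have hi := densityForm_integrable Real.pi_pos.le
    (integrable_weylDensity hq hM) measurable_weylLeft
    measurable_weylRight ae_weylLeft_mem ae_weylRight_mem hz hy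
  rw [weylForm, densityForm, integral_weylMeasure hi]
  have hqi : IntervalIntegrable (fun t => z t * (q t * y t)) volume 0 Real.pi :=
    (hz.mul (hq.mul hy)).intervalIntegrable_of_Icc Real.pi_pos.le
  have hfi : IntervalIntegrable (fun t => z t * weylForcing q M y t) volume 0 Real.pi :=
    (intervalIntegrable_weylForcing hq hM hy).continuousOn_mul
      (by rwa [uIcc_of_le Real.pi_pos.le])
  have hMi : IntervalIntegrable (fun t => z t * ∫ s in (0 : ℝ)..t, M t s * y s) volume 0 Real.pi :=
    (hfi.sub hqi).congr (fun t _ => by simp only [weylForcing]; ring)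
  simp only [weylForcing, mul_add]
  rw [intervalIntegral.integral_add hqi hMi]
  simp only [intervalIntegral.integral_of_le Real.pi_pos.le, ← integral_Icc_eq_integral_Ioc]
  congr 1
  · refine integral_congr_ae (Eventually.of_forall fun t => ?_)
    simp only [weylDensity, Sum.elim_inl, id]
    ring
  · have h2 := (integrable_indicator_iff measurableSet_weylTriangle).2
      (integrable_weylMeasure_iff.1 hi).2
    rw [← integral_indicator measurableSet_weylTriangle, Measure.volume_eq_prod,
      integral_prod _ h2]
    simp only [integral_indicator_weylTriangle]
    rw [integral_indicator measurableSet_Icc]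
    refine integral_congr_ae (Eventually.of_forall fun t => ?_)
    simp only [weylDensity, Sum.elim_inr, ← intervalIntegral.integral_const_mul]
    congr 1
    ext s
    ring

/-- The contributions of `M` cancel, so the difference of the forms lives on the diagonal. -/
theorem weylForm_eq_add (hq : ContinuousOn q (Icc 0 Real.pi))
    (hqt : ContinuousOn qt (Icc 0 Real.pi))
    (hM : IntegrableOn (fun p : ℝ × ℝ => M p.1 p.2) weylTriangle) {z y : ℝ → ℂ}
    (hz : ContinuousOn z (Icc 0 Real.pi)) (hy : ContinuousOn y (Icc 0 Real.pi)) :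
    weylForm q M z y = weylForm qt M z y
      + densityForm (volume.restrict (Icc 0 Real.pi)) (fun x => q x - qt x) id id z y := by
  rw [weylForm_eq_integral hq hM hz hy, weylForm_eq_integral hqt hM hz hy, ← sub_eq_iff_eq_add',
    ← intervalIntegral.integral_sub]
  · rw [densityForm, intervalIntegral.integral_of_le Real.pi_pos.le, ← integral_Icc_eq_integral_Ioc]
    refine integral_congr_ae (Eventually.of_forall fun t => ?_)
    simp only [weylForcing, id]; ring
  · exact (intervalIntegrable_weylForcing hq hM hy).continuousOn_mul
      (by rwa [uIcc_of_le Real.pi_pos.le])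
  · exact (intervalIntegrable_weylForcing hqt hM hy).continuousOn_mul
      (by rwa [uIcc_of_le Real.pi_pos.le])

/-! ### Solutions of the integro-differential equation -/

/-- Absolute continuity makes `y'` differentiable almost everywhere, so the second `derivWithin` in
the equation is a genuine derivative there and not a default value. -/
theorem IsSolution.isForcedSolution {ρ : ℂ} {y : ℝ → ℂ} (h : IsSolution q M (ρ ^ 2) y) :
    IsForcedSolution ρ Real.pi (weylForcing q M y) y (derivWithin y (Icc 0 Real.pi)) := by
  refine ⟨fun x hx => (h.differentiableOn x hx).hasDerivWithinAt, h.absolutelyContinuous, ?_⟩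
  have he := (ae_restrict_iff' measurableSet_Icc).1 h.equation
  have hd := h.absolutelyContinuous.ae_differentiableAt_complex
  rw [uIcc_of_le Real.pi_pos.le] at hd
  filter_upwards [he, hd] with x h1 h2 hx
  have h3 := (h2 hx).hasDerivAt
  refine h3.congr_deriv ?_
  rw [← h3.hasDerivWithinAt.derivWithin (uniqueDiffOn_Icc Real.pi_pos x hx), weylForcing]
  linear_combination -(h1 hx)

theorem IsForcedSolution.isSolution {ρ : ℂ} {f y y₁ : ℝ → ℂ}
    (h : IsForcedSolution ρ Real.pi f y y₁) (hf : ∀ x ∈ Icc 0 Real.pi, f x = weylForcing q M y x) :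
    IsSolution q M (ρ ^ 2) y ∧ derivWithin y (Icc 0 Real.pi) 0 = y₁ 0 := by
  have hu := uniqueDiffOn_Icc Real.pi_pos
  have he : EqOn (derivWithin y (Icc 0 Real.pi)) y₁ (Icc 0 Real.pi) :=
    fun x hx => (h.hasDerivWithinAt x hx).derivWithin (hu x hx)
  refine ⟨⟨fun x hx => (h.hasDerivWithinAt x hx).differentiableWithinAt,
    h.absolutelyContinuous.congr_of_eqOn (by rwa [uIcc_of_le Real.pi_pos.le]), ?_⟩,
    he ⟨le_rfl, Real.pi_pos.le⟩⟩
  rw [ae_restrict_iff' measurableSet_Icc]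
  filter_upwards [h.ode] with x h1 hx
  rw [derivWithin_congr he (he hx), (h1 hx).hasDerivWithinAt.derivWithin (hu x hx), hf x hx,
    weylForcing]
  ring

theorem weylForcing_congr {y y' : ℝ → ℂ} (h : EqOn y y' (Icc 0 Real.pi)) {x : ℝ}
    (hx : x ∈ Icc 0 Real.pi) : weylForcing q M y x = weylForcing q M y' x := by
  rw [weylForcing, weylForcing, h hx]
  congr 1
  refine intervalIntegral.integral_congr fun t ht => ?_
  rw [uIcc_of_le hx.1] at ht
  rw [h ⟨ht.1, ht.2.trans hx.2⟩]

theorem IsWeylSolution.eq_freeSolution_sub (hq : ContinuousOn q (Icc 0 Real.pi))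
    (hM : IntegrableOn (fun p : ℝ × ℝ => M p.1 p.2) weylTriangle) {ρ : ℂ} (hρ : ρ ≠ 0)
    (hs : Complex.sin (ρ * Real.pi) ≠ 0) {y : ℝ → ℂ} (h : IsWeylSolution q M (ρ ^ 2) y) :
    (∀ x ∈ Icc 0 Real.pi, y x
      = freeSolution ρ Real.pi x - weylForm q M (greenKernel ρ Real.pi x) y) ∧
    derivWithin y (Icc 0 Real.pi) 0
      = -(ρ * Complex.cos (ρ * Real.pi) / Complex.sin (ρ * Real.pi))
        - weylForm q M (freeSolution ρ Real.pi) y := by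
  have hy := h.1.isForcedSolution
  have hyc := hy.continuousOn
  refine ⟨fun x hx => ?_, ?_⟩
  · rw [weylForm_eq_integral hq hM
      ((continuous_greenKernel ρ Real.pi).uncurry_left x).continuousOn hyc]
    exact hy.eq_freeSolution_sub Real.pi_pos hρ hs (intervalIntegrable_weylForcing hq hM hyc)
      h.2.1 h.2.2 hx
  · rw [weylForm_eq_integral hq hM (continuous_freeSolution ρ Real.pi).continuousOn hyc]
    exact hy.deriv_zero_eq Real.pi_pos hs h.2.1 h.2.2

/-- The forcing is frozen at `y` and the linear problem solved by some `Y`. The Green representation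
of `Y` is the right side of the equation of `y`, so `Y = y` on `[0, π]` and `Y` generates its own
forcing. -/
theorem exists_isWeylSolution_of_eq (hq : ContinuousOn q (Icc 0 Real.pi))
    (hM : IntegrableOn (fun p : ℝ × ℝ => M p.1 p.2) weylTriangle) {ρ : ℂ} (hρ : ρ ≠ 0)
    (hs : Complex.sin (ρ * Real.pi) ≠ 0) {y : ℝ → ℂ} (hyc : ContinuousOn y (Icc 0 Real.pi))
    (hy : ∀ x ∈ Icc 0 Real.pi, y x
      = freeSolution ρ Real.pi x - weylForm q M (greenKernel ρ Real.pi x) y) :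
    ∃ Φ, IsWeylSolution q M (ρ ^ 2) Φ := by
  have hf := intervalIntegrable_weylForcing hq hM hyc
  obtain ⟨Y, Y₁, hY, hY0, hYπ⟩ := exists_isForcedSolution Real.pi_pos hs hf
  have hEq : EqOn y Y (Icc 0 Real.pi) := fun x hx => by
    rw [hy x hx, hY.eq_freeSolution_sub Real.pi_pos hρ hs hf hY0 hYπ hx,
      weylForm_eq_integral hq hM
        ((continuous_greenKernel ρ Real.pi).uncurry_left x).continuousOn hyc]
  exact ⟨Y, (hY.isSolution fun x hx => weylForcing_congr hEq hx).1, hY0, hYπ⟩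

/-- Unique solvability, with an integral equation for the solution and a formula for the
Weyl-type function, when the Green kernel is small. -/
theorem weylDefinedAt_of_greenKernel_le (hq : ContinuousOn q (Icc 0 Real.pi))
    (hM : IntegrableOn (fun p : ℝ × ℝ => M p.1 p.2) weylTriangle) {ρ : ℂ} (hρ : ρ ≠ 0)
    (hs : Complex.sin (ρ * Real.pi) ≠ 0) {h C : ℝ}
    (hG : ∀ x ∈ Icc 0 Real.pi, ∀ t ∈ Icc 0 Real.pi, ‖greenKernel ρ Real.pi x t‖ ≤ h)
    (hsmall : h * (∫ ω, ‖weylDensity q M ω‖ ∂weylMeasure) ≤ 1 / 2)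
    (hP : ∀ x ∈ Icc 0 Real.pi, ‖freeSolution ρ Real.pi x‖ ≤ C) :
    WeylDefinedAt q M (ρ ^ 2) ∧ ∃ y : ℝ → ℂ, ContinuousOn y (Icc 0 Real.pi) ∧
      (∀ x ∈ Icc 0 Real.pi, y x
        = freeSolution ρ Real.pi x - weylForm q M (greenKernel ρ Real.pi x) y) ∧
      (∀ x ∈ Icc 0 Real.pi, ‖y x - freeSolution ρ Real.pi x‖
        ≤ 2 * (h * ∫ ω, ‖weylDensity q M ω‖ ∂weylMeasure) * C) ∧
      weylN q M (ρ ^ 2) = -(ρ * Complex.cos (ρ * Real.pi) / Complex.sin (ρ * Real.pi))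
        - weylForm q M (freeSolution ρ Real.pi) y := by
  have ha := integrable_weylDensity hq hM
  have hGc := continuous_greenKernel ρ Real.pi
  obtain ⟨y, hyc, hy, hyb⟩ := exists_eq_sub_densityForm Real.pi_pos.le ha measurable_weylLeft
    measurable_weylRight ae_weylLeft_mem ae_weylRight_mem hGc hG hsmall
    (continuous_freeSolution ρ Real.pi).continuousOn hP
  have huniq : ∀ Φ, IsWeylSolution q M (ρ ^ 2) Φ → EqOn Φ y (Icc 0 Real.pi) := fun Φ hΦ =>
    eqOn_of_eq_sub_densityForm Real.pi_pos.le ha measurable_weylLeft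
      measurable_weylRight ae_weylLeft_mem ae_weylRight_mem hGc hG hsmall
      hΦ.1.differentiableOn.continuousOn hyc (hΦ.eq_freeSolution_sub hq hM hρ hs).1 hy
  have hdef : WeylDefinedAt q M (ρ ^ 2) :=
    ⟨exists_isWeylSolution_of_eq hq hM hρ hs hyc hy,
      fun Φ Ψ hΦ hΨ => (huniq Φ hΦ).trans (huniq Ψ hΨ).symm⟩
  refine ⟨hdef, y, hyc, hy, hyb, ?_⟩
  -- The solution picked by `choose` agrees with `y` on `[0, π]`, and the form sees nothing else.
  have hsol := hdef.1.choose_spec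
  rw [weylN, dif_pos hdef, (hsol.eq_freeSolution_sub hq hM hρ hs).2]
  congr 1
  exact densityForm_congr ae_weylLeft_mem ae_weylRight_mem (fun _ _ => rfl) (huniq _ hsol)

end

noncomputable section

/-! ### Laplace integrals -/

theorem integrableOn_pow_mul_exp_neg_mul_Ioi (k : ℕ) {s : ℝ} (hs : 0 < s) :
    IntegrableOn (fun x : ℝ => x ^ k * Real.exp (-(s * x))) (Ioi 0) := by
  have h := integrableOn_rpow_mul_exp_neg_mul_rpow (s := k) (p := 1) (b := s)
    (by have : (0 : ℝ) ≤ k := k.cast_nonneg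
        linarith) one_pos hs
  refine h.congr_fun (fun x _ => ?_) measurableSet_Ioi
  simp

theorem integral_pow_mul_exp_neg_mul_Ioi (k : ℕ) {s : ℝ} (hs : 0 < s) :
    ∫ x in Ioi (0 : ℝ), x ^ k * Real.exp (-(s * x)) = k.factorial / s ^ (k + 1) := by
  have h := Real.integral_rpow_mul_exp_neg_mul_Ioi (a := k + 1) (r := s) (by positivity) hs
  rw [Real.Gamma_nat_eq_factorial] at h
  simp only [add_sub_cancel_right, Real.rpow_natCast] at h
  rw [h, show (k : ℝ) + 1 = ((k + 1 : ℕ) : ℝ) by push_cast; rfl, Real.rpow_natCast]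
  rw [div_pow, one_pow]; ring

theorem norm_cexp_neg_mul_ofReal (r : ℂ) (x : ℝ) :
    ‖Complex.exp (-(r * x))‖ = Real.exp (-(r.re * x)) := by
  rw [Complex.norm_exp]; simp

theorem integrableOn_pow_mul_cexp_neg_mul_Ioi (k : ℕ) {r : ℂ} (hr : 0 < r.re) :
    IntegrableOn (fun x : ℝ => (x : ℂ) ^ k * Complex.exp (-(r * x))) (Ioi 0) := by
  refine (integrableOn_pow_mul_exp_neg_mul_Ioi k hr).mono'
    (Continuous.aestronglyMeasurable (by fun_prop)) ?_
  rw [ae_restrict_iff' measurableSet_Ioi]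
  refine Eventually.of_forall fun x hx => ?_
  rw [norm_mul, norm_pow, norm_cexp_neg_mul_ofReal, Complex.norm_real, Real.norm_of_nonneg hx.le]

/-- Induction on `k`: the derivative of `x^(k+1) exp(-rx)` integrates to zero over the half-line. -/
theorem integral_pow_mul_cexp_neg_mul_Ioi (k : ℕ) {r : ℂ} (hr : 0 < r.re) :
    ∫ x in Ioi (0 : ℝ), (x : ℂ) ^ k * Complex.exp (-(r * x)) = k.factorial / r ^ (k + 1) := by
  have hr0 : r ≠ 0 := by rintro rfl; simp at hr
  induction k with
  | zero =>
    have h := integral_exp_mul_complex_Ioi (a := -r) (by simpa using hr) 0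
    simp only [neg_mul] at h
    simp [h]
  | succ k ih =>
    have i1 := integrableOn_pow_mul_cexp_neg_mul_Ioi k hr
    have i2 := integrableOn_pow_mul_cexp_neg_mul_Ioi (k + 1) hr
    have hd : ∀ x ∈ Ici (0 : ℝ), HasDerivAt
        (fun x : ℝ => (x : ℂ) ^ (k + 1) * Complex.exp (-(r * x)))
        ((k + 1 : ℂ) * ((x : ℂ) ^ k * Complex.exp (-(r * x)))
          - r * ((x : ℂ) ^ (k + 1) * Complex.exp (-(r * x)))) x := fun x _ => by
      have e := hasDerivAt_cexp_mul_ofReal (-r) x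
      simp only [neg_mul] at e
      have p : HasDerivAt (fun x : ℝ => (x : ℂ) ^ (k + 1)) ((k + 1 : ℂ) * (x : ℂ) ^ k) x := by
        have := (hasDerivAt_pow (k + 1) (x : ℂ)).comp_ofReal
        simpa using this
      exact (p.fun_mul e).congr_deriv (by ring)
    have ht : Tendsto (fun x : ℝ => (x : ℂ) ^ (k + 1) * Complex.exp (-(r * x))) atTop (𝓝 0) := by
      rw [tendsto_zero_iff_norm_tendsto_zero]
      refine (tendsto_rpow_mul_exp_neg_mul_atTop_nhds_zero (k + 1 : ℕ) r.re hr).congr' ?_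
      filter_upwards [eventually_ge_atTop 0] with x hx
      rw [norm_mul, norm_pow, norm_cexp_neg_mul_ofReal, Complex.norm_real,
        Real.norm_of_nonneg hx, Real.rpow_natCast, neg_mul]
    have key := integral_Ioi_of_hasDerivAt_of_tendsto' hd
      ((i1.const_mul _).sub (i2.const_mul _)) ht
    rw [integral_sub (i1.const_mul _) (i2.const_mul _), integral_const_mul, integral_const_mul,
      ih] at key
    simp only [Complex.ofReal_zero, ne_eq, Nat.add_eq_zero_iff, one_ne_zero, and_false,
      not_false_eq_true, zero_pow, zero_mul, sub_zero] at key
    have : r * ∫ x in Ioi (0 : ℝ), (x : ℂ) ^ (k + 1) * Complex.exp (-(r * x))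
        = (k + 1) * (k.factorial / r ^ (k + 1)) := by linear_combination -key
    rw [Nat.factorial_succ, eq_div_iff (pow_ne_zero _ hr0), pow_succ _ (k + 1)]
    push_cast
    field_simp at this ⊢
    linear_combination this

/-- The integral of a function of size `x ^ k` against a decaying exponential. -/
theorem integral_Icc_norm_le_of_norm_le {b s A : ℝ} {k : ℕ} (hs : 0 < s) {f : ℝ → ℂ}
    (hA : 0 ≤ A) (hf : ∀ x ∈ Icc 0 b, ‖f x‖ ≤ A * (x ^ k * Real.exp (-(s * x)))) :
    ‖∫ x in Icc 0 b, f x‖ ≤ A * (k.factorial / s ^ (k + 1)) := by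
  have hi : IntegrableOn (fun x : ℝ => A * (x ^ k * Real.exp (-(s * x)))) (Ioi 0) :=
    (integrableOn_pow_mul_exp_neg_mul_Ioi k hs).const_mul A
  rw [← integral_pow_mul_exp_neg_mul_Ioi k hs, ← integral_const_mul, integral_Icc_eq_integral_Ioc]
  refine (norm_integral_le_of_norm_le (hi.mono_set Ioc_subset_Ioi_self) ?_).trans
    (setIntegral_mono_set hi ?_ (Ioc_subset_Ioi_self.eventuallyLE))
  · rw [ae_restrict_iff' measurableSet_Ioc]
    exact Eventually.of_forall fun x hx => hf x (Ioc_subset_Icc_self hx)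
  · filter_upwards [ae_restrict_mem measurableSet_Ioi] with x hx
    have : (0 : ℝ) < x := hx
    positivity

/-- Watson's lemma on a finite interval, with an explicit remainder. -/
theorem norm_laplace_sub_le {b C : ℝ} (hb : 0 < b) (hC : 0 ≤ C) {p : ℝ → ℂ} {c r : ℂ} {k : ℕ}
    (hr : 0 < r.re)
    (hp : ContinuousOn p (Icc 0 b))
    (hpc : ∀ x ∈ Icc 0 b, ‖p x - c * ((x : ℂ) ^ k / k.factorial)‖ ≤ C * x ^ (k + 1)) :
    ‖(∫ x in Icc 0 b, p x * Complex.exp (-(r * x))) - c / r ^ (k + 1)‖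
      ≤ (C + ‖c‖ / (k.factorial * b)) * ((k + 1).factorial / r.re ^ (k + 2)) := by
  have hk : (0 : ℝ) < k.factorial := by exact_mod_cast k.factorial_pos
  have hk' : (k.factorial : ℂ) ≠ 0 := by exact_mod_cast k.factorial_ne_zero
  -- Extension by zero allows comparison with the exact Laplace integral over the half-line.
  have i1 : IntegrableOn ((Ioc 0 b).indicator fun x => p x * Complex.exp (-(r * x))) (Ioi 0) := by
    refine ((integrable_indicator_iff measurableSet_Ioc).2 ?_).integrableOn
    exact (ContinuousOn.mul hp (by fun_prop)).integrableOn_Icc.mono_set Ioc_subset_Icc_self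
  have i2 := (integrableOn_pow_mul_cexp_neg_mul_Ioi k hr).const_mul (c / k.factorial)
  have e1 : ∫ x in Icc 0 b, p x * Complex.exp (-(r * x))
      = ∫ x in Ioi 0, (Ioc 0 b).indicator (fun x => p x * Complex.exp (-(r * x))) x := by
    rw [integral_Icc_eq_integral_Ioc, integral_indicator measurableSet_Ioc,
      Measure.restrict_restrict measurableSet_Ioc, inter_eq_left.2 Ioc_subset_Ioi_self]
  have e2 : c / r ^ (k + 1)
      = ∫ x in Ioi (0 : ℝ), c / k.factorial * ((x : ℂ) ^ k * Complex.exp (-(r * x))) := by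
    rw [integral_const_mul, integral_pow_mul_cexp_neg_mul_Ioi k hr]
    field_simp
  rw [e1, e2, ← integral_sub i1 i2, ← integral_pow_mul_exp_neg_mul_Ioi (k + 1) hr,
    ← integral_const_mul]
  refine norm_integral_le_of_norm_le
    ((integrableOn_pow_mul_exp_neg_mul_Ioi (k + 1) hr).const_mul _) ?_
  rw [ae_restrict_iff' measurableSet_Ioi]
  refine Eventually.of_forall fun x hx => ?_
  have hx0 : (0 : ℝ) < x := hx
  rw [← mul_assoc _ (x ^ (k + 1))]
  by_cases hxb : x ∈ Ioc 0 b
  · rw [indicator_of_mem hxb]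
    have : p x * Complex.exp (-(r * x)) - c / k.factorial * ((x : ℂ) ^ k * Complex.exp (-(r * x)))
        = (p x - c * ((x : ℂ) ^ k / k.factorial)) * Complex.exp (-(r * x)) := by ring
    rw [this, norm_mul, norm_cexp_neg_mul_ofReal]
    gcongr
    refine (hpc x (Ioc_subset_Icc_self hxb)).trans ?_
    gcongr
    exact le_add_of_nonneg_right (by positivity)
  -- Beyond `b` only the monomial remains, and `x^k ≤ x^(k+1) / b` turns it into a remainder of the
  -- next order; hence the summand `‖c‖ / (k! b)`.
  · have hbx : b ≤ x := by
      by_contra h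
      exact hxb ⟨hx0, (not_le.1 h).le⟩
    rw [indicator_of_notMem hxb, zero_sub, norm_neg, norm_mul, norm_mul, norm_cexp_neg_mul_ofReal,
      norm_pow, Complex.norm_real, Real.norm_of_nonneg hx0.le, norm_div, Complex.norm_natCast,
      ← mul_assoc]
    refine mul_le_mul_of_nonneg_right ?_ (Real.exp_pos _).le
    calc ‖c‖ / k.factorial * x ^ k = ‖c‖ / (k.factorial * b) * (x ^ k * b) := by field_simp
      _ ≤ ‖c‖ / (k.factorial * b) * (x ^ k * x) := by gcongr
      _ = ‖c‖ / (k.factorial * b) * x ^ (k + 1) := by rw [pow_succ]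
      _ ≤ _ := by gcongr; exact le_add_of_nonneg_left hC

/-! ### Bounds in the upper half-plane -/

theorem norm_sin_mul_ofReal_le {ρ : ℂ} (hρ : 0 ≤ ρ.im) {x : ℝ} (hx : 0 ≤ x) :
    ‖Complex.sin (ρ * x)‖ ≤ Real.exp (ρ.im * x) := by
  have h0 : 0 ≤ ρ.im * x := mul_nonneg hρ hx
  rw [Complex.sin, norm_div, norm_mul, Complex.norm_I, mul_one, Complex.norm_two]
  have h1 : ‖Complex.exp (-(ρ * x) * Complex.I)‖ = Real.exp (ρ.im * x) := by
    rw [Complex.norm_exp]; simp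
  have h2 : ‖Complex.exp (ρ * x * Complex.I)‖ ≤ Real.exp (ρ.im * x) := by
    rw [Complex.norm_exp]; simp; linarith
  have := norm_sub_le (Complex.exp (-(ρ * x) * Complex.I)) (Complex.exp (ρ * x * Complex.I))
  linarith

theorem le_norm_sin_mul_ofReal {ρ : ℂ} {b : ℝ} (h : Real.exp (-(2 * (ρ.im * b))) ≤ 1 / 2) :
    Real.exp (ρ.im * b) / 4 ≤ ‖Complex.sin (ρ * b)‖ := by
  rw [Complex.sin, norm_div, norm_mul, Complex.norm_I, mul_one, Complex.norm_two]
  have h1 : ‖Complex.exp (-(ρ * b) * Complex.I)‖ = Real.exp (ρ.im * b) := by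
    rw [Complex.norm_exp]; simp
  have h2 : ‖Complex.exp (ρ * b * Complex.I)‖ = Real.exp (-(2 * (ρ.im * b))) * Real.exp (ρ.im * b)
      := by
    rw [Complex.norm_exp, ← Real.exp_add]; simp; ring
  have := norm_sub_norm_le (Complex.exp (-(ρ * b) * Complex.I)) (Complex.exp (ρ * b * Complex.I))
  have := Real.exp_pos (ρ.im * b)
  nlinarith

theorem norm_inv_sin_mul_ofReal_le {ρ : ℂ} {b : ℝ}
    (h : Real.exp (-(2 * (ρ.im * b))) ≤ 1 / 2) :
    ‖Complex.sin (ρ * b)‖⁻¹ ≤ 4 * Real.exp (-(ρ.im * b)) := by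
  rw [Real.exp_neg]
  have h1 := le_norm_sin_mul_ofReal h
  have h2 := Real.exp_pos (ρ.im * b)
  calc _ ≤ (Real.exp (ρ.im * b) / 4)⁻¹ := inv_anti₀ (by positivity) h1
    _ = _ := by field_simp

theorem norm_freeSolution_le {ρ : ℂ} {b x : ℝ} (hρ : 0 ≤ ρ.im)
    (h : Real.exp (-(2 * (ρ.im * b))) ≤ 1 / 2) (hx : x ∈ Icc 0 b) :
    ‖freeSolution ρ b x‖ ≤ 4 * Real.exp (-(ρ.im * x)) := by
  rw [freeSolution, div_eq_mul_inv, norm_mul, norm_inv]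
  calc _ ≤ Real.exp (ρ.im * (b - x)) * (4 * Real.exp (-(ρ.im * b))) := by
        gcongr
        · exact norm_sin_mul_ofReal_le hρ (sub_nonneg.2 hx.2)
        · exact norm_inv_sin_mul_ofReal_le h
    _ = 4 * (Real.exp (ρ.im * (b - x)) * Real.exp (-(ρ.im * b))) := by ring
    _ = _ := by rw [← Real.exp_add]; ring_nf

/-- The difference is exactly `-sin(ρx) exp(iρb) / sin(ρb)`, the wave reflected at `b`. -/
theorem norm_freeSolution_sub_exp_le {ρ : ℂ} {b x : ℝ} (hρ : 0 ≤ ρ.im)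
    (h : Real.exp (-(2 * (ρ.im * b))) ≤ 1 / 2) (hx : x ∈ Icc 0 b) :
    ‖freeSolution ρ b x - Complex.exp (Complex.I * ρ * x)‖ ≤ 4 * Real.exp (-(ρ.im * b)) := by
  have hpos : 0 < ‖Complex.sin (ρ * b)‖ :=
    lt_of_lt_of_le (by positivity) (le_norm_sin_mul_ofReal h)
  have hs : Complex.sin (ρ * b) ≠ 0 := norm_pos_iff.1 hpos
  have key : freeSolution ρ b x - Complex.exp (Complex.I * ρ * x)
      = -(Complex.sin (ρ * x) * Complex.exp (ρ * b * Complex.I)) * (Complex.sin (ρ * b))⁻¹ := by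
    have e : Complex.sin (ρ * (b - x : ℝ)) = Complex.sin (ρ * b) * Complex.cos (ρ * x)
        - Complex.cos (ρ * b) * Complex.sin (ρ * x) := by
      rw [← Complex.sin_sub]; congr 1; push_cast; ring
    rw [freeSolution, e, show Complex.I * ρ * x = ρ * x * Complex.I by ring,
      Complex.exp_mul_I, Complex.exp_mul_I]
    field_simp
    ring
  have h2 : ‖Complex.exp (ρ * b * Complex.I)‖ = Real.exp (-(ρ.im * b)) := by
    rw [Complex.norm_exp]; simp
  rw [key, norm_mul, norm_neg, norm_mul, norm_inv, h2]
  calc _ ≤ Real.exp (ρ.im * x) * Real.exp (-(ρ.im * b)) * (4 * Real.exp (-(ρ.im * b))) := by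
        gcongr
        · exact norm_sin_mul_ofReal_le hρ hx.1
        · exact norm_inv_sin_mul_ofReal_le h
    _ ≤ Real.exp (ρ.im * b) * Real.exp (-(ρ.im * b)) * (4 * Real.exp (-(ρ.im * b))) := by
        gcongr
        exact hx.2
    _ = _ := by rw [← Real.exp_add]; simp

/-- The exponents add up through `min - max = -|x - t|`. This decay, beyond mere boundedness,
absorbs the exponential weight of the transposed equation. -/
theorem norm_greenKernel_le {ρ : ℂ} {b x t : ℝ} (hρ : 0 ≤ ρ.im)
    (h : Real.exp (-(2 * (ρ.im * b))) ≤ 1 / 2) (hx : x ∈ Icc 0 b) (ht : t ∈ Icc 0 b) :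
    ‖greenKernel ρ b x t‖ ≤ 4 / ‖ρ‖ * Real.exp (-(ρ.im * |x - t|)) := by
  rw [greenKernel, norm_div, norm_mul, norm_mul, div_eq_mul_inv, mul_inv]
  have h1 : (0 : ℝ) ≤ min x t := le_min hx.1 ht.1
  have h2 : (0 : ℝ) ≤ b - max x t := sub_nonneg.2 (max_le hx.2 ht.2)
  calc _ ≤ (Real.exp (ρ.im * min x t) * Real.exp (ρ.im * (b - max x t)))
          * (‖ρ‖⁻¹ * (4 * Real.exp (-(ρ.im * b)))) := by
        gcongr
        · exact norm_sin_mul_ofReal_le hρ h1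
        · exact norm_sin_mul_ofReal_le hρ h2
        · exact norm_inv_sin_mul_ofReal_le h
    _ = 4 / ‖ρ‖ * (Real.exp (ρ.im * min x t) * Real.exp (ρ.im * (b - max x t))
          * Real.exp (-(ρ.im * b))) := by ring
    _ = _ := by
        rw [← Real.exp_add, ← Real.exp_add, ← max_sub_min_eq_abs']
        ring_nf

theorem sin_mul_norm_le_im {δ : ℝ} (hδ : δ ∈ Ioo 0 (Real.pi / 2)) {ρ : ℂ} (hρ : ρ ∈ sectorQ δ) :
    Real.sin δ * ‖ρ‖ ≤ ρ.im := by
  rw [← Complex.norm_mul_sin_arg, mul_comm]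
  gcongr
  have h1 := hρ.1
  have h2 := hρ.2
  rcases le_total ρ.arg (Real.pi / 2) with h | h
  · exact Real.sin_le_sin_of_le_of_le_pi_div_two (by linarith [hδ.1, Real.pi_pos]) h h1
  · rw [← Real.sin_pi_sub ρ.arg]
    exact Real.sin_le_sin_of_le_of_le_pi_div_two (by linarith [hδ.1, Real.pi_pos])
      (by linarith) (by linarith)

end

noncomputable section

/-! ### Asymptotics of the difference of Weyl-type functions -/

theorem exists_norm_sub_taylor_le {k : ℕ} {q qt : ℝ → ℂ}
    (hq : AnalyticOn ℝ q (Icc 0 Real.pi)) (hqt : AnalyticOn ℝ qt (Icc 0 Real.pi))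
    (hcoeff : ∀ j < k, taylorCoeffZero q j - taylorCoeffZero qt j = 0) :
    ∃ C : ℝ, 0 ≤ C ∧ ∀ x ∈ Icc 0 Real.pi,
      ‖(q x - qt x) - (taylorCoeffZero q k - taylorCoeffZero qt k)
        * ((x : ℂ) ^ k / k.factorial)‖ ≤ C * x ^ (k + 1) := by
  have hu := uniqueDiffOn_Icc Real.pi_pos
  have h0 : (0 : ℝ) ∈ Icc 0 Real.pi := ⟨le_rfl, Real.pi_pos.le⟩
  have hc := hq.contDiffOn (n := (k + 1 : ℕ)) hu
  have hct := hqt.contDiffOn (n := (k + 1 : ℕ)) hu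
  have hd : ∀ j ≤ k, iteratedDerivWithin j (q - qt) (Icc 0 Real.pi) 0
      = taylorCoeffZero q j - taylorCoeffZero qt j := fun j hj =>
    iteratedDerivWithin_sub h0 hu ((hc 0 h0).of_le (by exact_mod_cast (by omega : j ≤ k + 1)))
      ((hct 0 h0).of_le (by exact_mod_cast (by omega : j ≤ k + 1)))
  obtain ⟨C, hC⟩ := exists_taylor_mean_remainder_bound (n := k) Real.pi_pos.le (hc.sub hct)
  -- The Taylor bound gives no sign for its constant.
  refine ⟨|C|, abs_nonneg C, fun x hx => ?_⟩
  have h1 := hC x hx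
  rw [taylor_within_apply, Finset.sum_range_succ, Finset.sum_eq_zero, zero_add] at h1
  · change ‖q x - qt x - _ • iteratedDerivWithin k (q - qt) _ _‖ ≤ _ at h1
    rw [hd k le_rfl, sub_zero, Complex.real_smul] at h1
    push_cast at h1
    have e : (taylorCoeffZero q k - taylorCoeffZero qt k) * ((x : ℂ) ^ k / k.factorial)
        = (k.factorial : ℂ)⁻¹ * (x : ℂ) ^ k * (taylorCoeffZero q k - taylorCoeffZero qt k) := by
      rw [div_eq_mul_inv]; ring
    rw [e]
    exact h1.trans (mul_le_mul_of_nonneg_right (le_abs_self C) (pow_nonneg hx.1 _))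
  · intro j hj
    have hj' := Finset.mem_range.1 hj
    change _ • iteratedDerivWithin j (q - qt) _ _ = _
    rw [hd j hj'.le, hcoeff j hj', smul_zero]

/-- The difference of the Weyl-type functions as an integral over products of solutions, which are
exponentially close to `exp (iρx)` up to relative errors of order `1 / ρ`. -/
theorem weylN_sub_weylN_eq {q qt : ℝ → ℂ} {M : ℝ → ℝ → ℂ}
    (hq : ContinuousOn q (Icc 0 Real.pi)) (hqt : ContinuousOn qt (Icc 0 Real.pi))
    (hM : IntegrableOn (fun p : ℝ × ℝ => M p.1 p.2) weylTriangle) {ρ : ℂ} (him : 1 ≤ ρ.im)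
    (hA : 8 * (∫ ω, ‖weylDensity q M ω‖ ∂weylMeasure) ≤ ‖ρ‖)
    (hAt : 8 * (∫ ω, ‖weylDensity qt M ω‖ ∂weylMeasure) ≤ ‖ρ‖) :
    WeylDefinedAt q M (ρ ^ 2) ∧ WeylDefinedAt qt M (ρ ^ 2) ∧ ∃ z y : ℝ → ℂ,
      ContinuousOn z (Icc 0 Real.pi) ∧ ContinuousOn y (Icc 0 Real.pi) ∧
      weylN q M (ρ ^ 2) - weylN qt M (ρ ^ 2)
        = -∫ x in Icc 0 Real.pi, (q x - qt x) * (z x * y x) ∧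
      ∀ x ∈ Icc 0 Real.pi, ‖z x * y x - Complex.exp (-(-2 * Complex.I * ρ * x))‖
        ≤ 9 * ((32 * ((∫ ω, ‖weylDensity q M ω‖ ∂weylMeasure)
          + ∫ ω, ‖weylDensity qt M ω‖ ∂weylMeasure)) / ‖ρ‖ + 4 / ρ.im)
          * Real.exp (-(ρ.im * x)) := by
  set A := ∫ ω, ‖weylDensity q M ω‖ ∂weylMeasure with hAdef
  set At := ∫ ω, ‖weylDensity qt M ω‖ ∂weylMeasure with hAtdef
  have hA0 : 0 ≤ A := integral_nonneg fun _ => norm_nonneg _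
  have hAt0 : 0 ≤ At := integral_nonneg fun _ => norm_nonneg _
  have him0 : 0 ≤ ρ.im := zero_le_one.trans him
  have hnorm : 1 ≤ ‖ρ‖ := him.trans ((le_abs_self _).trans (Complex.abs_im_le_norm ρ))
  have hnorm0 : 0 < ‖ρ‖ := one_pos.trans_le hnorm
  have hρ : ρ ≠ 0 := norm_pos_iff.1 hnorm0
  have hπ := Real.pi_gt_three
  have hexp : Real.exp (-(2 * (ρ.im * Real.pi))) ≤ 1 / 2 := by
    rw [Real.exp_neg, one_div]
    refine inv_anti₀ two_pos ?_
    have := Real.add_one_le_exp (2 * (ρ.im * Real.pi))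
    nlinarith
  have hs : Complex.sin (ρ * Real.pi) ≠ 0 :=
    norm_pos_iff.1 (lt_of_lt_of_le (by positivity) (le_norm_sin_mul_ofReal hexp))
  have hG : ∀ x ∈ Icc 0 Real.pi, ∀ t ∈ Icc 0 Real.pi,
      ‖greenKernel ρ Real.pi x t‖ ≤ 4 / ‖ρ‖ := fun x hx t ht => by
    refine (norm_greenKernel_le him0 hexp hx ht).trans (mul_le_of_le_one_right (by positivity) ?_)
    rw [Real.exp_le_one_iff]
    have := mul_nonneg him0 (abs_nonneg (x - t))
    linarith
  have hG' : ∀ x ∈ Icc 0 Real.pi, ∀ t ∈ Icc 0 Real.pi,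
      ‖Complex.exp (Complex.I * ρ * (t - x : ℝ)) * greenKernel ρ Real.pi x t‖ ≤ 4 / ‖ρ‖ :=
    fun x hx t ht => by
    rw [norm_mul, Complex.norm_exp]
    have e : (Complex.I * ρ * (t - x : ℝ)).re = -(ρ.im * (t - x)) := by simp
    rw [e]
    calc _ ≤ Real.exp (-(ρ.im * (t - x))) * (4 / ‖ρ‖ * Real.exp (-(ρ.im * |x - t|))) := by
          gcongr
          exact norm_greenKernel_le him0 hexp hx ht
      _ = 4 / ‖ρ‖ * Real.exp (-(ρ.im * (t - x)) + -(ρ.im * |x - t|)) := by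
          rw [Real.exp_add]; ring
      _ ≤ _ := by
          refine mul_le_of_le_one_right (by positivity) ?_
          rw [Real.exp_le_one_iff]
          nlinarith [mul_le_mul_of_nonneg_left (le_abs_self (x - t)) him0]
  -- The `8` in the hypotheses is the Green bound `4` divided by the contraction constant `1 / 2`.
  have hsm : 4 / ‖ρ‖ * A ≤ 1 / 2 := by
    rw [div_mul_eq_mul_div, div_le_iff₀ hnorm0]; linarith
  have hsmt : 4 / ‖ρ‖ * At ≤ 1 / 2 := by
    rw [div_mul_eq_mul_div, div_le_iff₀ hnorm0]; linarith
  have hP : ∀ x ∈ Icc 0 Real.pi, ‖freeSolution ρ Real.pi x‖ ≤ 4 * Real.exp (-(ρ.im * x)) :=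
    fun x hx => norm_freeSolution_le him0 hexp hx
  have hle1 : ∀ x ∈ Icc 0 Real.pi, Real.exp (-(ρ.im * x)) ≤ 1 := fun x hx => by
    rw [Real.exp_le_one_iff]
    have := mul_nonneg him0 hx.1
    linarith
  have hP4 : ∀ x ∈ Icc 0 Real.pi, ‖freeSolution ρ Real.pi x‖ ≤ 4 :=
    fun x hx => (hP x hx).trans (by linarith [hle1 x hx])
  have hre : (Complex.I * ρ).re = -ρ.im := by simp
  obtain ⟨hdef, y, hyc, hy, -, hN⟩ := weylDefinedAt_of_greenKernel_le hq hM hρ hs hG hsm hP4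
  obtain ⟨hdeft, yt, hytc, hyt, hytb, hNt⟩ :=
    weylDefinedAt_of_greenKernel_le hqt hM hρ hs hG hsmt hP4
  obtain ⟨z, hzc, hz, hzb⟩ := exists_eq_sub_densityForm_left_of_le (c := Complex.I * ρ)
    (by rw [hre]; linarith) Real.pi_pos.le (integrable_weylDensity hq hM) measurable_weylLeft
    measurable_weylRight ae_weylLeft_mem ae_weylRight_mem ae_weylRight_le_weylLeft
    (continuous_greenKernel ρ Real.pi) hG' hsm (continuous_freeSolution ρ Real.pi).continuousOn
    (C := 4) (fun x hx => by rw [hre, neg_mul]; exact hP x hx)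
  refine ⟨hdef, hdeft, z, yt, hzc, hytc, ?_, fun x hx => ?_⟩
  · have hid := densityForm_sub_densityForm_eq (μ' := volume.restrict (Icc 0 Real.pi))
      (a' := fun x => q x - qt x) (l' := id) (r' := id) Real.pi_pos.le
      (integrable_weylDensity hq hM) measurable_weylLeft
      measurable_weylRight ae_weylLeft_mem ae_weylRight_mem (hq.sub hqt).integrableOn_Icc
      measurable_id measurable_id (ae_restrict_mem measurableSet_Icc)
      (ae_restrict_mem measurableSet_Icc) (continuous_greenKernel ρ Real.pi)
      (greenKernel_comm ρ Real.pi) (fun u v hu hv => weylForm_eq_add hq hqt hM hu hv)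
      (continuous_freeSolution ρ Real.pi).continuousOn hzc hyc hytc hz hy hyt
    have hint : ∫ x in Icc 0 Real.pi, (q x - qt x) * (z x * yt x)
        = weylForm q M (freeSolution ρ Real.pi) y - weylForm qt M (freeSolution ρ Real.pi) yt := by
      refine Eq.trans ?_ hid.symm
      simp only [densityForm, id, mul_assoc]
    rw [hN, hNt, hint]; ring
  · set E := Complex.exp (Complex.I * ρ * x) with hE
    have hEE : Complex.exp (-(-2 * Complex.I * ρ * x)) = E * E := by
      rw [hE, ← Complex.exp_add]; congr 1; ring
    have hEn : ‖E‖ = Real.exp (-(ρ.im * x)) := by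
      rw [hE, Complex.norm_exp]; simp
    -- An exponentially small reflection term is weakened to order `1 / Im ρ`, which is all that is
    -- needed.
    have htail : 4 * Real.exp (-(ρ.im * Real.pi)) ≤ 4 / ρ.im := by
      rw [Real.exp_neg, ← div_eq_mul_inv]
      have h1 := Real.add_one_le_exp (ρ.im * Real.pi)
      exact div_le_div_of_nonneg_left (by norm_num) (by linarith) (by nlinarith)
    have hPE := (norm_freeSolution_sub_exp_le him0 hexp hx).trans htail
    rw [← hE] at hPE
    have hzb' := hzb x hx
    rw [hre, neg_mul, ← hAdef] at hzb'
    have hytb' := hytb x hx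
    rw [← hAtdef] at hytb'
    set e := Real.exp (-(ρ.im * x)) with he
    have he0 : 0 < e := Real.exp_pos _
    have he1 : e ≤ 1 := hle1 x hx
    have t1 : 2 * (4 / ‖ρ‖ * A) * 4 = 32 * A / ‖ρ‖ := by ring
    have t2 : 2 * (4 / ‖ρ‖ * At) * 4 = 32 * At / ‖ρ‖ := by ring
    have hdist : 32 * (A + At) / ‖ρ‖ = 32 * A / ‖ρ‖ + 32 * At / ‖ρ‖ := by ring
    have hA32 : 0 ≤ 32 * A / ‖ρ‖ := by positivity
    have hAt32 : 0 ≤ 32 * At / ‖ρ‖ := by positivity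
    set B := 32 * (A + At) / ‖ρ‖ + 4 / ρ.im with hB
    have hyE : ‖yt x - E‖ ≤ B := by
      have := norm_sub_le_norm_sub_add_norm_sub (yt x) (freeSolution ρ Real.pi x) E
      linarith
    have hzE : ‖z x - E‖ ≤ B := by
      have := norm_sub_le_norm_sub_add_norm_sub (z x) (freeSolution ρ Real.pi x) E
      have h32 : 32 * A / ‖ρ‖ * e ≤ 32 * A / ‖ρ‖ := mul_le_of_le_one_right hA32 he1
      rw [t1] at hzb'
      linarith
    have hzn : ‖z x‖ ≤ 8 * e := by
      have h1 := norm_le_norm_add_norm_sub' (z x) (freeSolution ρ Real.pi x)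
      have h2 : 2 * (4 / ‖ρ‖ * A) * 4 * e ≤ 4 * e := by
        refine mul_le_mul_of_nonneg_right ?_ he0.le
        linarith
      have h3 := hP x hx
      linarith
    -- The splitting pairs the undecayed error of `yt` with `z`, which is at most `8 * e`; the other
    -- term carries `‖E‖ = e`. Together they give the factor `9`.
    have hsplit : z x * yt x - E * E = z x * (yt x - E) + E * (z x - E) := by ring
    rw [hEE, hsplit]
    calc _ ≤ ‖z x‖ * ‖yt x - E‖ + ‖E‖ * ‖z x - E‖ := by
          refine (norm_add_le _ _).trans ?_
          rw [norm_mul, norm_mul]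
      _ ≤ 8 * e * B + e * B := by
          rw [hEn]
          gcongr
      _ = _ := by ring

/-- The limit with a rate. The factor `x^k` from the vanishing Taylor coefficients makes the
`O(1/ρ)` error of the product of solutions contribute at order `‖ρ‖^(-k-2)`, one below the main
term. -/
theorem exists_norm_weylN_sub_le {k : ℕ} {δ : ℝ} (hδ : δ ∈ Ioo 0 (Real.pi / 2))
    {q qt : ℝ → ℂ} {M : ℝ → ℝ → ℂ}
    (hM : IntegrableOn (fun p : ℝ × ℝ => M p.1 p.2) weylTriangle)
    (hq : AnalyticOn ℝ q (Icc 0 Real.pi)) (hqt : AnalyticOn ℝ qt (Icc 0 Real.pi))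
    (hcoeff : ∀ j < k, taylorCoeffZero q j - taylorCoeffZero qt j = 0) :
    ∃ R K : ℝ, ∀ ρ ∈ sectorQ δ, R ≤ ‖ρ‖ →
      (WeylDefinedAt q M (ρ ^ 2) ∧ WeylDefinedAt qt M (ρ ^ 2)) ∧
      ‖-((-2 * Complex.I * ρ) ^ (k + 1) * (weylN q M (ρ ^ 2) - weylN qt M (ρ ^ 2)))
        - (taylorCoeffZero q k - taylorCoeffZero qt k)‖ ≤ K * ‖ρ‖⁻¹ := by
  obtain ⟨C, hC0, hC⟩ := exists_norm_sub_taylor_le hq hqt hcoeff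
  set c := taylorCoeffZero q k - taylorCoeffZero qt k with hc
  set A := ∫ ω, ‖weylDensity q M ω‖ ∂weylMeasure with hAdef
  set At := ∫ ω, ‖weylDensity qt M ω‖ ∂weylMeasure with hAtdef
  have hA0 : 0 ≤ A := integral_nonneg fun _ => norm_nonneg _
  have hAt0 : 0 ≤ At := integral_nonneg fun _ => norm_nonneg _
  have hs : 0 < Real.sin δ :=
    Real.sin_pos_of_pos_of_lt_pi hδ.1 (hδ.2.trans (by linarith [Real.pi_pos]))
  set s := Real.sin δ with hsdef
  have hk : (0 : ℝ) < k.factorial := by exact_mod_cast k.factorial_pos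
  set K₁ := C + ‖c‖ / (k.factorial * Real.pi) with hK₁
  set K₂ := ‖c‖ / k.factorial + C * Real.pi with hK₂
  set B := 32 * (A + At) + 4 / s with hB
  have hK₁0 : 0 ≤ K₁ := by have := Real.pi_pos; positivity
  have hK₂0 : 0 ≤ K₂ := by have := Real.pi_pos; positivity
  have hB0 : 0 ≤ B := by positivity
  have hqbound : ∀ x ∈ Icc 0 Real.pi, ‖q x - qt x‖ ≤ K₂ * x ^ k := fun x hx => by
    have h1 := norm_le_norm_add_norm_sub' (q x - qt x) (c * ((x : ℂ) ^ k / k.factorial))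
    have h2 := hC x hx
    have h3 : ‖c * ((x : ℂ) ^ k / k.factorial)‖ = ‖c‖ / k.factorial * x ^ k := by
      rw [norm_mul, norm_div, norm_pow, Complex.norm_real, Real.norm_of_nonneg hx.1,
        Complex.norm_natCast]
      ring
    have h4 : C * x ^ (k + 1) ≤ C * Real.pi * x ^ k := by
      rw [pow_succ', mul_assoc]
      exact mul_le_mul_of_nonneg_left
        (mul_le_mul_of_nonneg_right hx.2 (pow_nonneg hx.1 k)) hC0
    rw [hK₂, add_mul]
    linarith
  -- The radius ensures `Im ρ ≥ 1` and both smallness conditions. The two summands of the constant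
  -- come from the Watson remainder and from replacing the product of solutions by `exp(2iρx)`.
  refine ⟨1 / s + 8 * A + 8 * At,
    K₁ * (k + 1).factorial / (2 * s ^ (k + 2))
      + 9 * K₂ * B * k.factorial * 2 ^ (k + 1) / s ^ (k + 1), fun ρ hρ hR => ?_⟩
  have him' := sin_mul_norm_le_im hδ hρ
  rw [← hsdef] at him'
  have h1s : 1 / s ≤ ‖ρ‖ := by linarith
  have hn0 : 0 < ‖ρ‖ := lt_of_lt_of_le (by positivity) h1s
  have him : 1 ≤ ρ.im := by
    rw [div_le_iff₀ hs] at h1s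
    linarith
  have him0 : 0 < ρ.im := one_pos.trans_le him
  have h1s0 : 0 < 1 / s := by positivity
  obtain ⟨hdef, hdeft, z, y, hzc, hyc, hN, hb⟩ := weylN_sub_weylN_eq hq.continuousOn
    hqt.continuousOn hM him (by linarith) (by linarith)
  rw [← hAdef, ← hAtdef] at hb
  refine ⟨⟨hdef, hdeft⟩, ?_⟩
  set r := -2 * Complex.I * ρ with hr
  have hrre : r.re = 2 * ρ.im := by simp [hr]
  have hrn : ‖r‖ = 2 * ‖ρ‖ := by simp [hr]
  have hrre0 : 0 < r.re := by rw [hrre]; positivity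
  have hr0 : r ≠ 0 := by
    rw [← norm_pos_iff, hrn]; positivity
  have hqd : ContinuousOn (fun x => q x - qt x) (Icc 0 Real.pi) :=
    hq.continuousOn.sub hqt.continuousOn
  have hw := norm_laplace_sub_le Real.pi_pos hC0 hrre0 hqd hC
  have hec : ContinuousOn (fun x : ℝ => Complex.exp (-(r * x))) (Icc 0 Real.pi) := by fun_prop
  have hrem : ‖∫ x in Icc 0 Real.pi, (q x - qt x) * (z x * y x - Complex.exp (-(r * x)))‖
      ≤ (K₂ * (9 * (B / ‖ρ‖))) * (k.factorial / ρ.im ^ (k + 1)) := by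
    refine integral_Icc_norm_le_of_norm_le him0 (by positivity) fun x hx => ?_
    have hBle : 32 * (A + At) / ‖ρ‖ + 4 / ρ.im ≤ B / ‖ρ‖ := by
      rw [hB, add_div, div_div]
      gcongr
    have hxk : 0 ≤ x ^ k := pow_nonneg hx.1 k
    rw [norm_mul]
    calc _ ≤ (K₂ * x ^ k) * (9 * (B / ‖ρ‖) * Real.exp (-(ρ.im * x))) := by
          gcongr
          · exact hqbound x hx
          · refine (hb x hx).trans ?_
            gcongr
      _ = _ := by ring
  have hsum : ∫ x in Icc 0 Real.pi, (q x - qt x) * (z x * y x)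
      = (∫ x in Icc 0 Real.pi, (q x - qt x) * Complex.exp (-(r * x)))
        + ∫ x in Icc 0 Real.pi, (q x - qt x) * (z x * y x - Complex.exp (-(r * x))) := by
    have i1 : IntegrableOn (fun x => (q x - qt x) * Complex.exp (-(r * x))) (Icc 0 Real.pi) :=
      (hqd.mul hec).integrableOn_Icc
    have i2 : IntegrableOn (fun x => (q x - qt x) * (z x * y x - Complex.exp (-(r * x))))
      (Icc 0 Real.pi) := (hqd.mul ((hzc.mul hyc).sub hec)).integrableOn_Icc
    rw [← integral_add i1 i2]
    refine integral_congr_ae (Eventually.of_forall fun x => ?_)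
    simp only
    ring
  have hfinal : -(r ^ (k + 1) * (weylN q M (ρ ^ 2) - weylN qt M (ρ ^ 2))) - c
      = r ^ (k + 1) * ((∫ x in Icc 0 Real.pi, (q x - qt x) * Complex.exp (-(r * x)))
          - c / r ^ (k + 1))
        + r ^ (k + 1) *
          ∫ x in Icc 0 Real.pi, (q x - qt x) * (z x * y x - Complex.exp (-(r * x))) := by
    rw [hN, hsum, mul_sub, mul_div_cancel₀ _ (pow_ne_zero _ hr0)]
    ring
  rw [hfinal]
  refine (norm_add_le _ _).trans ?_
  rw [norm_mul, norm_mul, norm_pow, hrn, add_mul]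
  rw [hrre] at hw
  refine add_le_add ?_ ?_
  · calc _ ≤ (2 * ‖ρ‖) ^ (k + 1) * (K₁ * ((k + 1).factorial / (2 * ρ.im) ^ (k + 2))) := by gcongr
      _ ≤ (2 * ‖ρ‖) ^ (k + 1) * (K₁ * ((k + 1).factorial / (2 * (s * ‖ρ‖)) ^ (k + 2))) := by
          gcongr
      _ = _ := by
          field_simp
          ring
  · calc _ ≤ (2 * ‖ρ‖) ^ (k + 1)
            * ((K₂ * (9 * (B / ‖ρ‖))) * (k.factorial / ρ.im ^ (k + 1))) := by gcongr
      _ ≤ (2 * ‖ρ‖) ^ (k + 1)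
            * ((K₂ * (9 * (B / ‖ρ‖))) * (k.factorial / (s * ‖ρ‖) ^ (k + 1))) := by gcongr
      _ = _ := by
          field_simp
          ring

end

theorem lemma3 (k : ℕ) (δ : ℝ) (hδ : δ ∈ Ioo 0 (Real.pi / 2))
    (q qt : ℝ → ℂ) (M : ℝ → ℝ → ℂ)
    (hM : IntegrableOn (fun p : ℝ × ℝ => M p.1 p.2)
      {p : ℝ × ℝ | 0 ≤ p.2 ∧ p.2 ≤ p.1 ∧ p.1 ≤ Real.pi})
    (hq : AnalyticOn ℝ q (Icc 0 Real.pi)) (hqt : AnalyticOn ℝ qt (Icc 0 Real.pi))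
    (hcoeff : ∀ j < k, taylorCoeffZero q j - taylorCoeffZero qt j = 0) :
    (∀ᶠ ρ in Bornology.cobounded ℂ ⊓ 𝓟 (sectorQ δ),
      WeylDefinedAt q M (ρ ^ 2) ∧ WeylDefinedAt qt M (ρ ^ 2)) ∧
    Tendsto
      (fun ρ : ℂ => -((-2 * Complex.I * ρ) ^ (k + 1) *
        (weylN q M (ρ ^ 2) - weylN qt M (ρ ^ 2))))
      (Bornology.cobounded ℂ ⊓ 𝓟 (sectorQ δ))
      (𝓝 (taylorCoeffZero q k - taylorCoeffZero qt k)) := by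
  obtain ⟨R, K, hRK⟩ := exists_norm_weylN_sub_le hδ hM hq hqt hcoeff
  have hev : ∀ᶠ ρ in Bornology.cobounded ℂ ⊓ 𝓟 (sectorQ δ), ρ ∈ sectorQ δ ∧ R ≤ ‖ρ‖ :=
    Eventually.and (mem_inf_of_right (mem_principal_self _))
      (mem_inf_of_left (tendsto_norm_cobounded_atTop.eventually_ge_atTop R))
  refine ⟨hev.mono fun ρ h => (hRK ρ h.1 h.2).1, ?_⟩
  rw [tendsto_iff_norm_sub_tendsto_zero]
  refine squeeze_zero' (Eventually.of_forall fun _ => norm_nonneg _)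
    (hev.mono fun ρ h => (hRK ρ h.1 h.2).2) ?_
  have h := (tendsto_inv_atTop_zero.comp (tendsto_norm_cobounded_atTop (E := ℂ))).const_mul K
  rw [mul_zero] at h
  exact h.mono_left inf_le_left
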